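/- For $q\in(0,1)$ let $\mathrm{Geo}(q)$ be the probability measure on $\mathbb{N}_0=\{0,1,2,\dots\}$ with weights $(1-q)q^x$, and let $M_0,M_1,M_2,\dots$ be its orthonormal polynomials, where $M_n$ has degree $n$ and leading coefficient $\kappa_n>0$. For an integer $N\ge 1$, the $N\times N$ Meixner ensemble is the determinantal point process $\lambda_1\ge\lambda_2\ge\dots\ge\lambda_N$ on $\mathbb{N}_0$ whose kernel with respect to $\mathrm{Geo}(q)$ is $$K_N(x,y)=\frac{\kappa_{N-1}}{\kappa_N}\cdot\frac{M_N(x)M_{N-1}(y)-M_{N-1}(x)M_N(y)}{x-y}$$ (for $x=y$, defined by taking the limit $y\to x$). Let $\nu_{q,N}=\mathbb{E}\bigl[\frac1N\sum_{i=1}^N\delta_{\lambda_i}\bigr]$ be its expected empirical distribution, let $X$ be distributed according to $\nu_{q,N}$, and let $\mu_q=\frac{(1+q^{1/2})^2}{1-q}$. Theorem. For every $W>0$ there exist positive constants $C_W$ and $N_0$, depending only on $W$, such that for all integers $N\ge N_0$ and $k\ge 1$ with $k\le WN^{2/3}$, and all $q\in[k^{-2},1)$, $$C_W^{-1}(q^{1/6}k)^{-3/2}(\mu_qN)^k\;\le\;\mathbb{E}[X^k]\;\le\;C_W(q^{1/6}k)^{-3/2}(\mu_qN)^k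 .$$ -/

import Mathlib

open MeasureTheory ProbabilityTheory Filter Topology Polynomial
open scoped ENNReal

noncomputable section

namespace Meixner

/-- The geometric distribution on `{0, 1, 2, …}` with weights `(1 - q) * q ^ x` (success
probability `1 - q`; the projection onto `[0, 1]` does nothing for the parameters `q ∈ (0, 1)`,
see `geo_real_singleton`). -/
def geo (q : ℝ) : Measure ℕ :=
  geometricMeasure (Set.projIcc (0 : ℝ) 1 zero_le_one (1 - q))

theorem geo_real_singleton {q : ℝ} (h0 : 0 < q) (h1 : q < 1) (x : ℕ) :
    (geo q).real {x} = (1 - q) * q ^ x := by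
  have hm : 1 - q ∈ Set.Icc (0 : ℝ) 1 := ⟨by linarith, by linarith⟩
  have hne : (⟨1 - q, hm⟩ : unitInterval) ≠ 0 := by
    intro h
    have h' := congrArg Subtype.val h
    simp only [Set.Icc.coe_zero] at h'
    linarith
  rw [geo, Set.projIcc_of_mem zero_le_one hm, geometricMeasure_real_singleton hne]
  simp only [sub_sub_cancel]
  ring

/-- The inner product of two polynomials in `L²` of the geometric distribution. -/
def polyInner (q : ℝ) (f g : ℝ[X]) : ℝ :=
  ∫ x : ℕ, f.eval (x : ℝ) * g.eval (x : ℝ) ∂(geo q)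

/-- The monic orthogonal polynomials of the geometric distribution: the Gram–Schmidt process
applied to `1, X, X ^ 2, …`. -/
def monicPoly (q : ℝ) (n : ℕ) : ℝ[X] :=
  X ^ n - ∑ j : Fin n,
    C (polyInner q (X ^ n) (monicPoly q j) / polyInner q (monicPoly q j) (monicPoly q j)) *
      monicPoly q j
  termination_by n
  decreasing_by all_goals exact j.2

/-- The orthonormal polynomial of degree `n` (with positive leading coefficient) of the
geometric distribution. -/
def orthoPoly (q : ℝ) (n : ℕ) : ℝ[X] :=
  C (Real.sqrt (polyInner q (monicPoly q n) (monicPoly q n)))⁻¹ * monicPoly q n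

/-- The Meixner kernel
`K_N(x, y) = (κ_{N-1} / κ_N) * (M_N(x) M_{N-1}(y) - M_{N-1}(x) M_N(y)) / (x - y)`, for `N ≥ 1`,
where `κ_n` is the leading coefficient of the orthonormal polynomial `M_n`. On the diagonal it is
the limit `y → x` of this expression, see `tendsto_kernel`. -/
def kernel (q : ℝ) (N : ℕ) (x y : ℝ) : ℝ :=
  (orthoPoly q (N - 1)).leadingCoeff / (orthoPoly q N).leadingCoeff *
    if x = y then
      (orthoPoly q N).derivative.eval x * (orthoPoly q (N - 1)).eval x -
        (orthoPoly q (N - 1)).derivative.eval x * (orthoPoly q N).eval x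
    else
      ((orthoPoly q N).eval x * (orthoPoly q (N - 1)).eval y -
        (orthoPoly q (N - 1)).eval x * (orthoPoly q N).eval y) / (x - y)

theorem tendsto_kernel (q : ℝ) (N : ℕ) (x : ℝ) :
    Tendsto (fun y => kernel q N x y) (𝓝[≠] x) (𝓝 (kernel q N x x)) := by
  set A := orthoPoly q N with hA
  set B := orthoPoly q (N - 1) with hB
  have hd : HasDerivAt (fun y => A.eval y * B.eval x - B.eval y * A.eval x)
      (A.derivative.eval x * B.eval x - B.derivative.eval x * A.eval x) x :=
    ((A.hasDerivAt x).mul_const _).sub ((B.hasDerivAt x).mul_const _)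
  have hs := hasDerivAt_iff_tendsto_slope.1 hd
  have hc : kernel q N x x = B.leadingCoeff / A.leadingCoeff *
      (A.derivative.eval x * B.eval x - B.derivative.eval x * A.eval x) := by
    simp [kernel, hA, hB]
  rw [hc]
  refine (hs.const_mul (B.leadingCoeff / A.leadingCoeff)).congr' ?_
  filter_upwards [self_mem_nhdsWithin] with y hy
  have hy' : x ≠ y := fun h => hy h.symm
  have h1 : x - y ≠ 0 := sub_ne_zero.2 hy'
  have h2 : y - x ≠ 0 := sub_ne_zero.2 hy
  rw [kernel, if_neg hy', slope_def_field, ← hA, ← hB]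
  congr 1
  field_simp
  ring

/-- The law `P` of a configuration of `N` random points `x 0, …, x (N - 1)` in `ℕ` is
*determinantal* with kernel `K` with respect to the reference measure `μ` on `ℕ`: for every `r`,
the `r`-th correlation function of the configuration with respect to `μ` is
`(y₁, …, y_r) ↦ det (K (y_i, y_j))`, i.e. the expected number of `r`-tuples of distinct particles
located at `(y₁, …, y_r)` is `det (K (y_i, y_j)) * ∏ μ {y_i}`. -/
def IsDeterminantal (μ : Measure ℕ) (K : ℝ → ℝ → ℝ) {N : ℕ} (P : Measure (Fin N → ℕ)) : Prop :=
  ∀ (r : ℕ) (y : Fin r → ℕ),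
    ∫ x : Fin N → ℕ, (Nat.card {s : Fin r ↪ Fin N // ∀ j, x (s j) = y j} : ℝ) ∂P =
      (Matrix.of fun i j : Fin r => K (y i) (y j)).det * ∏ j, μ.real {y j}

/-- `P` is the law of the points `λ₁ ≥ λ₂ ≥ … ≥ λ_N` of the `N × N` Meixner ensemble with
parameter `q`: the determinantal point process on `ℕ` with the Meixner kernel with respect to the
geometric distribution. -/
structure IsMeixnerEnsemble (q : ℝ) (N : ℕ) (P : Measure (Fin N → ℕ)) : Prop where
  isProbabilityMeasure : IsProbabilityMeasure P
  antitone : ∀ᵐ x ∂P, Antitone x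
  determinantal : IsDeterminantal (geo q) (kernel q N) P

/-- The expected empirical distribution `𝔼[(1 / N) ∑ δ_{λ_i}]` of `N` random points with joint
law `P`: the mean of the random measure that sends a configuration `x` to
`(1 / N) ∑ δ_{x i}`. -/
def meanEmpirical {N : ℕ} (P : Measure (Fin N → ℕ)) : Measure ℕ :=
  P.bind fun x => (N : ℝ≥0∞)⁻¹ • ∑ i, Measure.dirac (x i)

/-- `μ_q = (1 + q ^ (1/2)) ^ 2 / (1 - q)`. -/
def edge (q : ℝ) : ℝ := (1 + Real.sqrt q) ^ 2 / (1 - q)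

end Meixner

end

/-! Write r = √q and split k = n + m with m = n or m = n + 1. The shifted factorial (x + m)(x + m -
1)⋯(x - n + 1) has k factors placed almost symmetrically around x, so it is comparable to x ^ k, and
its expectation can be computed exactly.

The density of the mean empirical law with respect to the geometric weight is (1 / N) ∑_{l < N}
M_l(x)². Multiplying the weight by this factorial and putting x = z + n gives, up to constants, the
negative binomial weight C(z + k, k) q ^ z, for which the Meixner polynomials of parameter k + 1 are
orthogonal. By generating functions, M_l(z + n) expands in those polynomials with coefficients that
are, up to signs and powers of r, the coefficients c_j of (r + X) ^ n (1 + r X) ^ m. Orthogonality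
leaves only the c_j², and summing over l < N gives the finite positive sum in
`integral_descFactorial`: ∑_j c_j² (N - j)(N - j + 1)⋯(N - j + k), divided by (k + 1) N (1 - q) ^ k.

The sum is estimated probabilistically. The numbers c_j / (1 + r) ^ k are the law of a sum of k
independent Bernoulli variables with mean within 1/2 of k / 2 and variance of order k r ≥ 1, so ∑
c_j² is of order (1 + r) ^ (2k) / √(k r). The rising factorial is N ^ (k + 1) exp((k + 1)(k / 2 - j)
/ N) up to an error O(k³ / N²) in the exponent, which is bounded because k = O(N ^ (2/3)); its
centre k / 2 matches that of the c_j. `weightedSum_le` combines a maximum bound with an exponential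
moment, and `le_weightedSum` uses concentration with Cauchy–Schwarz. `moment_bounds` passes back
from factorials to powers. -/

noncomputable section

namespace Meixner

/-! ### Coefficients of the generating polynomial: maximum and exponential moments -/

/-- The binomial weights are bounded by the inverse of a standard deviation. -/
theorem choose_mul_pow_le (n j : ℕ) {p : ℝ} (h0 : 0 < p) (h1 : p < 1) :
    (n.choose j : ℝ) * p ^ j * (1 - p) ^ (n - j) ≤ 1 / √((n + 1) * p * (1 - p)) := by
  have h1' : 0 < 1 - p := by linarith
  set v : ℝ := (n + 1) * p * (1 - p) with hv
  have hv0 : 0 < v := by positivity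
  set a : ℕ → ℝ := fun i => (n.choose i : ℝ) * p ^ i * (1 - p) ^ (n - i) with ha
  set b : ℕ → ℝ := fun i => ((n + 1).choose i : ℝ) * p ^ i * (1 - p) ^ (n + 1 - i) with hb
  have hb0 : ∀ i, 0 ≤ b i := fun i => by simp only [hb]; positivity
  have hsum : ∑ i ∈ Finset.range (n + 2), b i = 1 := by
    have := congrArg (Polynomial.eval p) (bernsteinPolynomial.sum ℝ (n + 1))
    simpa [bernsteinPolynomial, Polynomial.eval_finsetSum] using this
  have hvar : ∑ i ∈ Finset.range (n + 2), ((n + 1) * p - i) ^ 2 * b i = v := by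
    have := congrArg (Polynomial.eval p) (bernsteinPolynomial.variance ℝ (n + 1))
    simpa [bernsteinPolynomial, Polynomial.eval_finsetSum] using this
  -- Consecutive Bin(n, p) weights differ by a Bin(n + 1, p) weight times its deviation from the
  -- mean over the variance v. Telescoping up to a (n + 1) = 0 bounds a j by the mean absolute
  -- deviation over v, hence by √v / v.
  have hdiff : ∀ i ≤ n, a i - a (i + 1) = b (i + 1) * ((i + 1) - (n + 1) * p) / v := by
    intro i hi
    have e1 : ((n + 1).choose (i + 1) : ℝ) * (i + 1) = (n + 1) * n.choose i := by
      exact_mod_cast (Nat.add_one_mul_choose_eq n i).symm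
    have e2 : ((n + 1).choose (i + 1) : ℝ) = n.choose i + n.choose (i + 1) := by
      exact_mod_cast Nat.choose_succ_succ n i
    have e3 : (n + 1 : ℝ) * n.choose (i + 1) = (n - i) * (n + 1).choose (i + 1) := by
      linear_combination (n + 1 : ℝ) * (-e2) + e1
    have e4 : a (i + 1) * (1 - p) = n.choose (i + 1) * p ^ (i + 1) * (1 - p) ^ (n - i) := by
      rcases hi.eq_or_lt with rfl | h
      · simp [ha]
      · simp only [ha]
        rw [show n - i = n - (i + 1) + 1 by omega]; ring
    have e5 : b (i + 1) = (n + 1).choose (i + 1) * p ^ (i + 1) * (1 - p) ^ (n - i) := by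
      simp only [hb]; rw [show n + 1 - (i + 1) = n - i by omega]
    rw [eq_div_iff hv0.ne', e5, hv]
    have : (a i - a (i + 1)) * ((n + 1) * p * (1 - p)) =
        (n + 1) * n.choose i * p ^ (i + 1) * (1 - p) ^ (n - i) * (1 - p) -
          (n + 1) * p * (a (i + 1) * (1 - p)) := by
      simp only [ha]; ring
    rw [this, e4, ← e1]
    linear_combination (- p ^ (i + 1) * p * (1 - p) ^ (n - i)) * e3
  have htel : ∀ j ≤ n + 1, a j = ∑ i ∈ Finset.Ico j (n + 1), (a i - a (i + 1)) := by
    intro j hj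
    have h := Finset.sum_Ico_sub a hj
    have h0 : a (n + 1) = 0 := by simp [ha]
    rw [← neg_inj, ← Finset.sum_neg_distrib]
    simp only [neg_sub]
    rw [h, h0]; ring
  have habs : ∀ i, b i * |(i : ℝ) - (n + 1) * p| ≤
      (((n + 1) * p - i) ^ 2 * b i / √v + √v * b i) / 2 := by
    intro i
    have hs : 0 < √v := Real.sqrt_pos.2 hv0
    have : |(i : ℝ) - (n + 1) * p| ≤ (((n + 1) * p - i) ^ 2 / √v + √v) / 2 := by
      rw [← sq_abs, abs_sub_comm, le_div_iff₀ two_pos, div_add' _ _ _ hs.ne', le_div_iff₀ hs]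
      nlinarith [sq_nonneg (|(n + 1) * p - (i : ℝ)| - √v)]
    calc _ ≤ b i * ((((n + 1) * p - i) ^ 2 / √v + √v) / 2) :=
          mul_le_mul_of_nonneg_left this (hb0 i)
      _ = _ := by ring
  have hE : ∑ i ∈ Finset.range (n + 2), b i * |(i : ℝ) - (n + 1) * p| ≤ √v := by
    refine (Finset.sum_le_sum fun i _ => habs i).trans ?_
    rw [← Finset.sum_div, Finset.sum_add_distrib, ← Finset.sum_div, hvar, ← Finset.mul_sum, hsum,
      Real.div_sqrt]
    linarith
  by_cases hj : j ≤ n + 1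
  · change a j ≤ _
    have hs : 0 < √v := Real.sqrt_pos.2 hv0
    have hstep : ∀ i ∈ Finset.Ico j (n + 1), a i - a (i + 1) ≤
        b (i + 1) * |((i + 1 : ℕ) : ℝ) - (n + 1) * p| / v := by
      intro i hi
      rw [hdiff i (by have := Finset.mem_Ico.1 hi; omega)]
      push_cast
      exact div_le_div_of_nonneg_right (mul_le_mul_of_nonneg_left (le_abs_self _) (hb0 _)) hv0.le
    rw [htel j hj]
    calc _ ≤ ∑ i ∈ Finset.Ico j (n + 1), b (i + 1) * |((i + 1 : ℕ) : ℝ) - (n + 1) * p| / v :=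
          Finset.sum_le_sum hstep
      _ ≤ ∑ i ∈ Finset.range (n + 1), b (i + 1) * |((i + 1 : ℕ) : ℝ) - (n + 1) * p| / v := by
          refine Finset.sum_le_sum_of_subset_of_nonneg ?_ fun i _ _ => ?_
          · intro i; simp
          · exact div_nonneg (mul_nonneg (hb0 _) (abs_nonneg _)) hv0.le
      _ ≤ ∑ i ∈ Finset.range (n + 2), b i * |(i : ℝ) - (n + 1) * p| / v := by
          rw [Finset.sum_range_succ' _ (n + 1)]
          exact le_add_of_nonneg_right (div_nonneg (mul_nonneg (hb0 _) (abs_nonneg _)) hv0.le)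
      _ ≤ √v / v := by
          rw [← Finset.sum_div]; gcongr
      _ = 1 / √v := by rw [Real.sqrt_div_self', one_div]
  · rw [Nat.choose_eq_zero_of_lt (by omega)]
    simp

/-- The generating polynomial `(r + X) ^ n * (1 + r * X) ^ m`. -/
def connPoly (r : ℝ) (n m : ℕ) : ℝ[X] := (C r + X) ^ n * (1 + C r * X) ^ m

theorem natDegree_connPoly_le (r : ℝ) (n m : ℕ) : (connPoly r n m).natDegree ≤ n + m := by
  unfold connPoly
  refine natDegree_mul_le.trans (add_le_add ?_ ?_)
  · exact (natDegree_pow_le_of_le n (m := 1) (by compute_degree)).trans (by simp)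
  · exact (natDegree_pow_le_of_le m (m := 1) (by compute_degree)).trans (by simp)

theorem sum_coeff_connPoly_mul_pow (r : ℝ) (n m : ℕ) (y : ℝ) :
    ∑ j ∈ Finset.range (n + m + 1), (connPoly r n m).coeff j * y ^ j =
      (r + y) ^ n * (1 + r * y) ^ m := by
  rw [← Polynomial.eval_eq_sum_range' (Nat.lt_succ_of_le (natDegree_connPoly_le r n m))]
  simp [connPoly]

theorem coeff_C_add_X_pow (r : ℝ) (n j : ℕ) :
    ((C r + X : ℝ[X]) ^ n).coeff j = n.choose j * r ^ (n - j) := by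
  rw [add_comm, Polynomial.coeff_X_add_C_pow, mul_comm]

theorem coeff_one_add_C_mul_X_pow (r : ℝ) (m j : ℕ) :
    ((1 + C r * X : ℝ[X]) ^ m).coeff j = m.choose j * r ^ j := by
  have h : (1 + C r * X : ℝ[X]) ^ m = ((1 + X) ^ m).comp (C r * X) := by simp
  rw [h, Polynomial.comp_C_mul_X_coeff, Polynomial.coeff_one_add_X_pow]

theorem coeff_connPoly_nonneg {r : ℝ} (hr : 0 ≤ r) (n m j : ℕ) :
    0 ≤ (connPoly r n m).coeff j := by
  rw [connPoly, Polynomial.coeff_mul]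
  refine Finset.sum_nonneg fun x _ => ?_
  rw [coeff_C_add_X_pow, coeff_one_add_C_mul_X_pow]
  positivity

/-- After division by (1 + r) ^ n these are binomial weights with success probability 1 / (1 + r).
Since r ≤ 1, the factor r / (1 + r)² in the variance is at least r / 4, whence the 2. -/
theorem coeff_C_add_X_pow_le {r : ℝ} (hr : 0 < r) (hr1 : r ≤ 1) (n j : ℕ) :
    ((C r + X : ℝ[X]) ^ n).coeff j ≤ (1 + r) ^ n * (2 / √((n + 1) * r)) := by
  rw [coeff_C_add_X_pow]
  rcases lt_or_ge n j with hj | hj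
  · rw [Nat.choose_eq_zero_of_lt hj]
    simp only [Nat.cast_zero, zero_mul]
    positivity
  have h := choose_mul_pow_le n j (p := 1 / (1 + r)) (by positivity)
    (by rw [div_lt_one (by positivity)]; linarith)
  have e : 1 - 1 / (1 + r) = r / (1 + r) := by field_simp; ring
  rw [e, div_pow, div_pow, one_pow] at h
  have e2 : (1 + r) ^ n = (1 + r) ^ j * (1 + r) ^ (n - j) := by
    rw [← pow_add]; congr 1; omega
  have e3 : (n.choose j : ℝ) * r ^ (n - j) = (1 + r) ^ n *
      (n.choose j * (1 / (1 + r) ^ j) * (r ^ (n - j) / (1 + r) ^ (n - j))) := by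
    rw [e2]; field_simp
  rw [e3]
  refine mul_le_mul_of_nonneg_left (h.trans ?_) (by positivity)
  have e4 : √((n + 1) * r) = √4 * √((n + 1) * r / 4) := by
    rw [← Real.sqrt_mul (by norm_num)]; congr 1; ring
  have e5 : √(4 : ℝ) = 2 := by
    rw [show (4 : ℝ) = 2 ^ 2 by norm_num]; exact Real.sqrt_sq (by norm_num)
  rw [e4, e5, ← div_div, div_self two_ne_zero]
  refine one_div_le_one_div_of_le (Real.sqrt_pos.2 (by positivity)) (Real.sqrt_le_sqrt ?_)
  have : (n + 1) * (1 / (1 + r)) * (r / (1 + r)) = (n + 1) * r / ((1 + r) ^ 2) := by field_simp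
  rw [this]
  gcongr
  nlinarith

/-- The coefficients of `connPoly` are bounded by the total mass over a standard deviation. -/
theorem coeff_connPoly_le {r : ℝ} (hr : 0 < r) (hr1 : r ≤ 1) (n m j : ℕ) :
    (connPoly r n m).coeff j ≤ (1 + r) ^ (n + m) * (2 / √((n + 1) * r)) := by
  -- Convolving with the nonnegative second factor, of total mass (1 + r) ^ m, cannot raise the
  -- maximum beyond that multiple; the spread comes from the first factor alone.
  rw [connPoly, mul_comm, Polynomial.coeff_mul]
  have hs : ∑ i ∈ Finset.range (j + 1), ((1 + C r * X : ℝ[X]) ^ m).coeff i ≤ (1 + r) ^ m := by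
    have hd : ((1 + C r * X : ℝ[X]) ^ m).natDegree < m + j + 1 :=
      Nat.lt_succ_of_le (((natDegree_pow_le_of_le m (m := 1)
        (by compute_degree)).trans (by simp)).trans (Nat.le_add_right m j))
    have h := Polynomial.eval_eq_sum_range' hd 1
    have h' : (1 + r) ^ m =
        ∑ i ∈ Finset.range (m + j + 1), ((1 + C r * X : ℝ[X]) ^ m).coeff i := by
      simpa using h
    rw [h']
    refine Finset.sum_le_sum_of_subset_of_nonneg (by intro i; simp; omega) fun i _ _ => ?_
    rw [coeff_one_add_C_mul_X_pow]; positivity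
  calc _ ≤ ∑ x ∈ Finset.HasAntidiagonal.antidiagonal j,
        ((1 + C r * X : ℝ[X]) ^ m).coeff x.1 * ((1 + r) ^ n * (2 / √((n + 1) * r))) := by
        refine Finset.sum_le_sum fun x _ => ?_
        refine mul_le_mul_of_nonneg_left (coeff_C_add_X_pow_le hr hr1 n _) ?_
        rw [coeff_one_add_C_mul_X_pow]; positivity
    _ = (∑ i ∈ Finset.range (j + 1), ((1 + C r * X : ℝ[X]) ^ m).coeff i) *
        ((1 + r) ^ n * (2 / √((n + 1) * r))) := by
        rw [← Finset.sum_mul, Finset.Nat.sum_antidiagonal_eq_sum_range_succ_mk]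
    _ ≤ (1 + r) ^ m * ((1 + r) ^ n * (2 / √((n + 1) * r))) := by gcongr
    _ = _ := by ring


theorem cosh_sub_one_le_sq {x : ℝ} (hx : |x| ≤ 1) : Real.cosh x - 1 ≤ x ^ 2 := by
  have h := Real.cosh_le_exp_half_sq x
  have h1 : x ^ 2 ≤ 1 := by rw [← sq_abs]; exact pow_le_one₀ (abs_nonneg _) hx
  have h2 := Real.abs_exp_sub_one_le (x := x ^ 2 / 2)
    (by rw [abs_of_nonneg (by positivity)]; linarith)
  rw [abs_of_nonneg (a := x ^ 2 / 2) (by positivity)] at h2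
  linarith [le_abs_self (Real.exp (x ^ 2 / 2) - 1)]

/-- The moment generating function of the (centred) coefficients of `connPoly`. -/
theorem sum_coeff_connPoly_mul_exp_le {r l : ℝ} (hr : 0 < r) {n m : ℕ}
    (hnm : m = n ∨ m = n + 1) (hl : |l| ≤ 1) :
    ∑ j ∈ Finset.range (n + m + 1),
        (connPoly r n m).coeff j * Real.exp (l * (((n + m : ℕ) : ℝ) / 2 - j)) ≤
      (1 + r) ^ (n + m) * Real.exp (((n + m : ℕ) : ℝ) * r * l ^ 2 + |l| / 2) := by
  have hsum : ∑ j ∈ Finset.range (n + m + 1),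
      (connPoly r n m).coeff j * Real.exp (l * (((n + m : ℕ) : ℝ) / 2 - j)) =
      Real.exp (l * (((n + m : ℕ) : ℝ) / 2)) *
        ((r + Real.exp (-l)) ^ n * (1 + r * Real.exp (-l)) ^ m) := by
    rw [← sum_coeff_connPoly_mul_pow, Finset.mul_sum]
    refine Finset.sum_congr rfl fun j _ => ?_
    rw [← Real.exp_nat_mul, mul_left_comm, ← Real.exp_add]
    ring_nf
  -- One factor of each kind, centred by e ^ l, gives (1 + r)² + 2r(cosh l - 1). There is no
  -- first-order term in l, which is why n and m are taken nearly equal.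
  have hbase : Real.exp l * ((r + Real.exp (-l)) * (1 + r * Real.exp (-l))) ≤
      (1 + r) ^ 2 * Real.exp (2 * r * l ^ 2) := by
    have e : Real.exp l * ((r + Real.exp (-l)) * (1 + r * Real.exp (-l))) =
        (1 + r) ^ 2 + 2 * r * (Real.cosh l - 1) := by
      have h1 : Real.exp l * Real.exp (-l) = 1 := by rw [← Real.exp_add]; simp
      rw [Real.cosh_eq]
      linear_combination (1 + r ^ 2 + r * Real.exp (-l)) * h1
    rw [e]
    have h1 := cosh_sub_one_le_sq hl
    have h2 := Real.add_one_le_exp (2 * r * l ^ 2)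
    have h3 : 0 ≤ 2 * r * l ^ 2 := by positivity
    nlinarith [mul_le_mul_of_nonneg_left h1 (by positivity : 0 ≤ 2 * r),
      mul_le_mul_of_nonneg_left h2 (by positivity : 0 ≤ (1 + r) ^ 2), mul_nonneg h3 hr.le,
      mul_nonneg h3 (sq_nonneg r)]
  have hpow : Real.exp (l * n) * ((r + Real.exp (-l)) ^ n * (1 + r * Real.exp (-l)) ^ n) ≤
      (1 + r) ^ (n + n) * Real.exp (((n + n : ℕ) : ℝ) * r * l ^ 2) := by
    have := pow_le_pow_left₀ (by positivity) hbase n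
    rw [mul_pow, mul_pow, mul_pow, ← Real.exp_nat_mul, ← Real.exp_nat_mul, ← pow_mul] at this
    have e : ((2 * n : ℕ) : ℝ) * r * l ^ 2 = n * (2 * r * l ^ 2) := by push_cast; ring
    rwa [← two_mul, mul_comm l, e]
  rw [hsum]
  rcases hnm with rfl | rfl
  · calc _ = Real.exp (l * m) * ((r + Real.exp (-l)) ^ m * (1 + r * Real.exp (-l)) ^ m) := by
          push_cast; ring_nf
      _ ≤ _ := hpow
      _ ≤ _ := by
          gcongr
          linarith [abs_nonneg l]
  -- The unpaired factor for m = n + 1 is off centre by at most 1/2, at the cost e ^ (|l| / 2).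
  · have hx : Real.exp (l / 2) * (1 + r * Real.exp (-l)) ≤ (1 + r) * Real.exp (|l| / 2) := by
      have e : Real.exp (l / 2) * (1 + r * Real.exp (-l)) =
          Real.exp (l / 2) + r * Real.exp (-l / 2) := by
        have : Real.exp (l / 2) * Real.exp (-l) = Real.exp (-l / 2) := by
          rw [← Real.exp_add]; ring_nf
        rw [← this]; ring
      rw [e]
      have h1 : Real.exp (l / 2) ≤ Real.exp (|l| / 2) :=
        Real.exp_le_exp.2 (by linarith [le_abs_self l])
      have h2 : Real.exp (-l / 2) ≤ Real.exp (|l| / 2) :=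
        Real.exp_le_exp.2 (by linarith [neg_le_abs l])
      nlinarith
    calc _ = (Real.exp (l * n) * ((r + Real.exp (-l)) ^ n * (1 + r * Real.exp (-l)) ^ n)) *
          (Real.exp (l / 2) * (1 + r * Real.exp (-l))) := by
          have : Real.exp (l * (((n + (n + 1) : ℕ) : ℝ) / 2)) =
              Real.exp (l * n) * Real.exp (l / 2) := by
            rw [← Real.exp_add]; push_cast; ring_nf
          rw [this]; ring
      _ ≤ ((1 + r) ^ (n + n) * Real.exp (((n + n : ℕ) : ℝ) * r * l ^ 2)) *
          ((1 + r) * Real.exp (|l| / 2)) := by gcongr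
      _ = (1 + r) ^ (n + (n + 1)) * Real.exp (((n + n : ℕ) : ℝ) * r * l ^ 2 + |l| / 2) := by
          rw [Real.exp_add]; ring
      _ ≤ _ := by
          gcongr
          omega

/-! ### Exponential bounds for rising factorials -/

theorem sum_range_cast_sub (k : ℕ) (a : ℝ) :
    ∑ i ∈ Finset.range (k + 1), ((i : ℝ) - a) = (k + 1) * ((k : ℝ) / 2 - a) := by
  induction k with
  | zero => simp
  | succ k ih => rw [Finset.sum_range_succ, ih]; push_cast; ring

theorem ascFactorial_sub_eq_prod {N j k : ℕ} (hj : j ≤ N) (hN : 0 < N) :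
    ((N - j).ascFactorial (k + 1) : ℝ) =
      (N : ℝ) ^ (k + 1) * ∏ i ∈ Finset.range (k + 1), (1 + ((i : ℝ) - j) / N) := by
  have hN' : (N : ℝ) ≠ 0 := by positivity
  rw [Nat.ascFactorial_eq_prod_range]
  push_cast
  rw [← Finset.card_range (k + 1), ← Finset.prod_const, Finset.card_range,
    ← Finset.prod_mul_distrib]
  refine Finset.prod_congr rfl fun i _ => ?_
  rw [Nat.cast_sub hj]
  field_simp
  ring

/-- Apply 1 + u ≤ e ^ u factor by factor. The exponents add up to a quantity vanishing at j = k / 2,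
the approximate centre of the coefficients of `connPoly`. -/
theorem ascFactorial_sub_le {N j k : ℕ} (hj : j ≤ N) (hN : 0 < N) :
    ((N - j).ascFactorial (k + 1) : ℝ) ≤
      (N : ℝ) ^ (k + 1) * Real.exp (((k : ℝ) + 1) / N * ((k : ℝ) / 2 - j)) := by
  have hN' : (0 : ℝ) < N := by positivity
  rw [ascFactorial_sub_eq_prod hj hN]
  refine mul_le_mul_of_nonneg_left ?_ (by positivity)
  have e : ((k : ℝ) + 1) / N * ((k : ℝ) / 2 - j) =
      ∑ i ∈ Finset.range (k + 1), (((i : ℝ) - j) / N) := by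
    rw [← Finset.sum_div, sum_range_cast_sub]; ring
  rw [e, Real.exp_sum]
  refine Finset.prod_le_prod (fun i _ => ?_) fun i _ => ?_
  · have : (j : ℝ) ≤ N := by exact_mod_cast hj
    rw [add_div' _ _ _ hN'.ne']
    apply div_nonneg _ hN'.le
    have : (0 : ℝ) ≤ i := by positivity
    linarith
  · linarith [Real.add_one_le_exp (((i : ℝ) - j) / N)]

theorem exp_sub_sq_le_one_add {u : ℝ} (hu : |u| ≤ 1 / 2) : Real.exp (u - u ^ 2) ≤ 1 + u := by
  have h1 := (abs_le.1 hu).1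
  have h2 := (abs_le.1 hu).2
  have hb : u - u ^ 2 ≤ 1 := by nlinarith
  have hb' : -1 ≤ u - u ^ 2 := by nlinarith
  have h := Real.norm_exp_sub_one_sub_id_le (x := u - u ^ 2)
    (by rw [Real.norm_eq_abs]; exact abs_le.2 ⟨hb', hb⟩)
  have h3 := le_abs_self (Real.exp (u - u ^ 2) - 1 - (u - u ^ 2))
  rw [Real.norm_eq_abs, Real.norm_eq_abs, sq_abs] at h
  by_cases h0 : 0 ≤ u
  · nlinarith [mul_nonneg h0 h0, mul_nonneg (mul_nonneg h0 h0) h0]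
  -- For u < 0 the quadratic remainder (u - u²)² exceeds u², so the reciprocal inequality is proved
  -- instead from a lower bound for exp.
  · have h4 : 0 < 1 + u := by linarith
    have h5 := Real.quadratic_le_exp_of_nonneg (x := -(u - u ^ 2)) (by nlinarith)
    have h7 : 0 ≤ (1 + u) * (1 - u) ^ 2 / 2 + u := by nlinarith [sq_nonneg u]
    have h6 : 1 ≤ (1 + u) * Real.exp (-(u - u ^ 2)) := by
      nlinarith [mul_nonneg h7 (sq_nonneg u)]
    calc Real.exp (u - u ^ 2)
        ≤ Real.exp (u - u ^ 2) * ((1 + u) * Real.exp (-(u - u ^ 2))) :=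
          le_mul_of_one_le_right (Real.exp_pos _).le h6
      _ = (1 + u) * (Real.exp (u - u ^ 2) * Real.exp (-(u - u ^ 2))) := by ring
      _ = 1 + u := by rw [← Real.exp_add]; simp

/-- The reverse bound costs u² per factor with |u| ≤ k / N ≤ 1/2, in total (k + 1)(k / N)², which
stays bounded when k³ = O(N²). -/
theorem le_ascFactorial_sub {N j k : ℕ} (hj : j ≤ k) (hk : 2 * k ≤ N) (hN : 0 < N) :
    (N : ℝ) ^ (k + 1) * Real.exp (((k : ℝ) + 1) / N * ((k : ℝ) / 2 - j) -
      (k + 1) * ((k : ℝ) / N) ^ 2) ≤ ((N - j).ascFactorial (k + 1) : ℝ) := by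
  have hN' : (0 : ℝ) < N := by positivity
  rw [ascFactorial_sub_eq_prod (by omega) hN]
  refine mul_le_mul_of_nonneg_left ?_ (by positivity)
  have e : ((k : ℝ) + 1) / N * ((k : ℝ) / 2 - j) - (k + 1) * ((k : ℝ) / N) ^ 2 =
      ∑ i ∈ Finset.range (k + 1), (((i : ℝ) - j) / N - ((k : ℝ) / N) ^ 2) := by
    rw [Finset.sum_sub_distrib, ← Finset.sum_div, sum_range_cast_sub]
    simp; ring
  rw [e, Real.exp_sum]
  refine Finset.prod_le_prod (fun i _ => (Real.exp_pos _).le) fun i hi => ?_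
  have hi' : i ≤ k := by have := Finset.mem_range.1 hi; omega
  have hik : (i : ℝ) ≤ k := by exact_mod_cast hi'
  have hjk : (j : ℝ) ≤ k := by exact_mod_cast hj
  have hkN : 2 * (k : ℝ) ≤ N := by exact_mod_cast hk
  have hu : |((i : ℝ) - j) / N| ≤ k / N := by
    rw [abs_div, abs_of_pos hN']
    gcongr
    exact abs_sub_le_of_nonneg_of_le (Nat.cast_nonneg _) hik (Nat.cast_nonneg _) hjk
  have hu2 : (k : ℝ) / N ≤ 1 / 2 := by rw [div_le_div_iff₀ hN' two_pos]; linarith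
  refine le_trans (Real.exp_le_exp.2 ?_) (exp_sub_sq_le_one_add (hu.trans hu2))
  have : (((i : ℝ) - j) / N) ^ 2 ≤ ((k : ℝ) / N) ^ 2 := by
    rw [← sq_abs]; exact pow_le_pow_left₀ (abs_nonneg _) hu 2
  linarith

/-! ### Two-sided bounds for the weighted sum of squares -/

/-- `(N + k - j) ! / (N - 1 - j) !` summed against the squared coefficients of `connPoly`,
where `k = n + m`. -/
def weightedSum (r : ℝ) (n m N : ℕ) : ℝ :=
  ∑ j ∈ Finset.range (n + m + 1),
    (connPoly r n m).coeff j ^ 2 * ((N - j).ascFactorial (n + m + 1) : ℝ)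

/-- One copy of each squared coefficient is replaced by the maximum bound; the other is summed
against the exponential weight as a moment generating function at l = (k + 1) / N. Its exponent k r
l² is at most 4 k³ / N² ≤ 4T. -/
theorem weightedSum_le {r T : ℝ} (hr : 0 < r) (hr1 : r ≤ 1) {n m N : ℕ}
    (hnm : m = n ∨ m = n + 1) (hk : 1 ≤ n + m) (hN : 2 * (n + m) ≤ N)
    (hT : ((n + m : ℕ) : ℝ) ^ 3 ≤ T * (N : ℝ) ^ 2) :
    weightedSum r n m N ≤ 4 * Real.exp (4 * T + 1 / 2) *
      ((N : ℝ) ^ (n + m + 1) * (1 + r) ^ (2 * (n + m)) / √(((n + m : ℕ) : ℝ) * r)) := by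
  set k := n + m with hkdef
  have hN0 : 0 < N := by omega
  have hNr : (0 : ℝ) < N := by positivity
  have hk1 : (1 : ℝ) ≤ k := by exact_mod_cast hk
  have hkN : 2 * (k : ℝ) ≤ N := by exact_mod_cast hN
  set l : ℝ := ((k : ℝ) + 1) / N with hl
  have hl0 : 0 ≤ l := by positivity
  have hl1 : |l| ≤ 1 := by
    rw [abs_of_nonneg hl0, hl, div_le_one hNr]; linarith
  have hmax : 2 / √((n + 1) * r) ≤ 4 / √(k * r) := by
    have h1 : √(k * r) ≤ √(4 * ((n + 1) * r)) := by
      refine Real.sqrt_le_sqrt ?_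
      have : (k : ℝ) ≤ 2 * n + 1 := by
        have : k ≤ 2 * n + 1 := by omega
        exact_mod_cast this
      nlinarith
    have h2 : √(4 * ((n + 1) * r)) = 2 * √((n + 1) * r) := by
      rw [Real.sqrt_mul (by norm_num), show (4 : ℝ) = 2 ^ 2 by norm_num,
        Real.sqrt_sq (by norm_num)]
    have h3 : 0 < √(k * r) := Real.sqrt_pos.2 (by positivity)
    have h4 : 0 < √((n + 1) * r) := Real.sqrt_pos.2 (by positivity)
    rw [div_le_div_iff₀ h4 h3]
    linarith
  have hexp : (k : ℝ) * r * l ^ 2 + |l| / 2 ≤ 4 * T + 1 / 2 := by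
    have h1 : l ≤ 2 * k / N := by rw [hl]; gcongr; linarith
    have h2 : (k : ℝ) * r * l ^ 2 ≤ k * 1 * (2 * k / N) ^ 2 := by gcongr
    have h3 : (k : ℝ) * 1 * (2 * k / N) ^ 2 = 4 * (k ^ 3 / N ^ 2) := by field_simp; ring
    have h4 : (k : ℝ) ^ 3 / N ^ 2 ≤ T := by rw [div_le_iff₀ (by positivity)]; exact hT
    linarith
  calc weightedSum r n m N
      ≤ ∑ j ∈ Finset.range (k + 1), ((1 + r) ^ k * (4 / √(k * r)) * (N : ℝ) ^ (k + 1)) *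
        ((connPoly r n m).coeff j * Real.exp (l * ((k : ℝ) / 2 - j))) := by
        refine Finset.sum_le_sum fun j hj => ?_
        have hj' : j ≤ k := by have := Finset.mem_range.1 hj; omega
        have h1 := ascFactorial_sub_le (k := k) (show j ≤ N by omega) hN0
        have h2 : (connPoly r n m).coeff j ≤ (1 + r) ^ k * (4 / √(k * r)) :=
          (coeff_connPoly_le hr hr1 n m j).trans (by gcongr)
        have h0 := coeff_connPoly_nonneg hr.le n m j
        calc _ ≤ ((1 + r) ^ k * (4 / √(k * r)) * (connPoly r n m).coeff j) *
              ((N : ℝ) ^ (k + 1) * Real.exp (l * ((k : ℝ) / 2 - j))) := by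
              refine mul_le_mul ?_ h1 (by positivity) (by positivity)
              rw [sq]
              exact mul_le_mul_of_nonneg_right h2 h0
          _ = _ := by ring
    _ ≤ ((1 + r) ^ k * (4 / √(k * r)) * (N : ℝ) ^ (k + 1)) *
        ((1 + r) ^ k * Real.exp (4 * T + 1 / 2)) := by
        rw [← Finset.mul_sum]
        refine mul_le_mul_of_nonneg_left ?_ (by positivity)
        refine (sum_coeff_connPoly_mul_exp_le hr hnm hl1).trans ?_
        gcongr
    _ = _ := by ring

/-- At least half of the mass of `connPoly` is near the centre. -/
theorem half_le_sum_coeff_connPoly {r : ℝ} (hr : 0 < r) {n m : ℕ} (hnm : m = n ∨ m = n + 1)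
    (hk : 1 ≤ ((n + m : ℕ) : ℝ) * r) :
    (1 + r) ^ (n + m) / 2 ≤
      ∑ j ∈ Finset.range (n + m + 1) with
        |((n + m : ℕ) : ℝ) / 2 - (j : ℕ)| ≤ 4 * √(((n + m : ℕ) : ℝ) * r),
          (connPoly r n m).coeff j := by
  set k := n + m with hkdef
  set s := √((k : ℝ) * r) with hs
  have hs1 : 1 ≤ s := by rw [hs, Real.one_le_sqrt]; exact hk
  have hs0 : 0 < s := by linarith
  have hss : s ^ 2 = k * r := Real.sq_sqrt (by linarith)
  have hth : |1 / s| ≤ 1 := by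
    rw [abs_of_pos (by positivity), div_le_one hs0]; exact hs1
  have hth' : |-(1 / s)| ≤ 1 := by rwa [abs_neg]
  have htot : ∑ j ∈ Finset.range (k + 1), (connPoly r n m).coeff j = (1 + r) ^ k := by
    have := sum_coeff_connPoly_mul_pow r n m 1
    simp only [one_pow, mul_one] at this
    rw [this, hkdef, pow_add, add_comm r 1]
  have hval : (k : ℝ) * r * (1 / s) ^ 2 = 1 := by
    rw [← hss]; field_simp
  have h1 := sum_coeff_connPoly_mul_exp_le hr hnm hth
  have h2 := sum_coeff_connPoly_mul_exp_le hr hnm hth'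
  rw [neg_sq, abs_neg] at h2
  rw [← hkdef, hval] at h1 h2
  have h3 : Real.exp (1 + |1 / s| / 2) ≤ Real.exp (3 / 2) :=
    Real.exp_le_exp.2 (by linarith)
  -- Chernoff bound at l = ±1 / s, where k r l² = 1: a deviation beyond 4s gains e ^ 4, while each
  -- exponential moment costs at most e ^ (3/2). Since 4 e ^ (3/2) ≤ e ^ 4, the two tails together
  -- hold at most half the mass.
  have htail : ∑ j ∈ Finset.range (k + 1) with ¬ |(k : ℝ) / 2 - (j : ℕ)| ≤ 4 * s,
      (connPoly r n m).coeff j * Real.exp 4 ≤ 2 * ((1 + r) ^ k * Real.exp (3 / 2)) := by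
    calc _ ≤ ∑ j ∈ Finset.range (k + 1) with ¬ |(k : ℝ) / 2 - (j : ℕ)| ≤ 4 * s,
          ((connPoly r n m).coeff j * Real.exp (1 / s * ((k : ℝ) / 2 - j)) +
            (connPoly r n m).coeff j * Real.exp (-(1 / s) * ((k : ℝ) / 2 - j))) := by
          refine Finset.sum_le_sum fun j hj => ?_
          have hj' := (Finset.mem_filter.1 hj).2
          have h0 := coeff_connPoly_nonneg hr.le n m j
          rw [← mul_add]
          refine mul_le_mul_of_nonneg_left ?_ h0
          have h4 : 4 ≤ |1 / s * ((k : ℝ) / 2 - j)| := by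
            rw [abs_mul, abs_of_pos (by positivity), div_mul_eq_mul_div, one_mul,
              le_div_iff₀ hs0]
            exact (not_le.1 hj').le
          rcases le_abs.1 h4 with h5 | h5
          · exact (Real.exp_le_exp.2 h5).trans (le_add_of_nonneg_right (Real.exp_pos _).le)
          · rw [neg_mul]
            exact (Real.exp_le_exp.2 h5).trans (le_add_of_nonneg_left (Real.exp_pos _).le)
      _ ≤ ∑ j ∈ Finset.range (k + 1),
          ((connPoly r n m).coeff j * Real.exp (1 / s * ((k : ℝ) / 2 - j)) +
            (connPoly r n m).coeff j * Real.exp (-(1 / s) * ((k : ℝ) / 2 - j))) := by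
          refine Finset.sum_le_sum_of_subset_of_nonneg (Finset.filter_subset _ _) fun j _ _ => ?_
          have h0 := coeff_connPoly_nonneg hr.le n m j
          positivity
      _ ≤ _ := by
          rw [Finset.sum_add_distrib]
          have : (1 + r) ^ k * Real.exp (1 + |1 / s| / 2) ≤ (1 + r) ^ k * Real.exp (3 / 2) := by
            gcongr
          linarith
  rw [← Finset.sum_mul] at htail
  have hE : 4 * Real.exp (3 / 2) ≤ Real.exp 4 := by
    have e : Real.exp 4 = Real.exp (5 / 2) * Real.exp (3 / 2) := by
      rw [← Real.exp_add]; norm_num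
    rw [e]
    have := Real.quadratic_le_exp_of_nonneg (x := 5 / 2) (by norm_num)
    exact mul_le_mul_of_nonneg_right (by linarith) (Real.exp_pos _).le
  have hsplit := Finset.sum_filter_add_sum_filter_not (Finset.range (k + 1))
    (fun j : ℕ => |(k : ℝ) / 2 - (j : ℕ)| ≤ 4 * s) (fun j => (connPoly r n m).coeff j)
  rw [htot] at hsplit
  have hfin : ∑ j ∈ Finset.range (k + 1) with ¬ |(k : ℝ) / 2 - (j : ℕ)| ≤ 4 * s,
      (connPoly r n m).coeff j ≤ (1 + r) ^ k / 2 := by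
    refine le_of_mul_le_mul_right (htail.trans ?_) (Real.exp_pos 4)
    have : 0 < (1 + r) ^ k := by positivity
    nlinarith
  linarith

theorem card_filter_abs_sub_le (K : ℕ) (a : ℝ) {D : ℝ} (hD : 0 ≤ D) :
    (((Finset.range K).filter fun j : ℕ => |a - (j : ℕ)| ≤ D).card : ℝ) ≤ 2 * D + 1 := by
  have hsub : ((Finset.range K).filter fun j : ℕ => |a - (j : ℕ)| ≤ D).image (fun j : ℕ => (j : ℤ))
      ⊆ Finset.Icc ⌈a - D⌉ ⌊a + D⌋ := by
    intro z hz
    obtain ⟨j, hj, rfl⟩ := Finset.mem_image.1 hz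
    have := abs_le.1 (Finset.mem_filter.1 hj).2
    rw [Finset.mem_Icc, Int.ceil_le, Int.le_floor]
    push_cast
    constructor <;> linarith
  have hc := Finset.card_le_card hsub
  rw [Finset.card_image_of_injective _ Nat.cast_injective, Int.card_Icc] at hc
  have h1 : (((⌊a + D⌋ + 1 - ⌈a - D⌉).toNat : ℤ) : ℝ) ≤ 2 * D + 1 := by
    rw [Int.toNat_eq_max]
    push_cast
    refine max_le ?_ (by linarith)
    linarith [Int.floor_le (a + D), Int.le_ceil (a - D)]
  refine le_trans (by exact_mod_cast hc) h1

/-- Cauchy–Schwarz on a window of at most 9s indices carrying half the mass gives ∑ c_j² ≥ (1 + r) ^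
(2k) / (36 s), where s = √(k r). The rising factorials lose only a bounded factor on this window. -/
theorem le_weightedSum {r T : ℝ} (hr : 0 < r) (hr1 : r ≤ 1) {n m N : ℕ}
    (hnm : m = n ∨ m = n + 1) (hkr : 1 ≤ ((n + m : ℕ) : ℝ) * r) (hN : 2 * (n + m) ≤ N)
    (hT : ((n + m : ℕ) : ℝ) ^ 3 ≤ T * (N : ℝ) ^ 2) :
    (1 / 36) * Real.exp (-(4 + 6 * T)) *
      ((N : ℝ) ^ (n + m + 1) * (1 + r) ^ (2 * (n + m)) / √(((n + m : ℕ) : ℝ) * r)) ≤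
    weightedSum r n m N := by
  have hhalf := half_le_sum_coeff_connPoly hr hnm hkr
  set k := n + m with hkdef
  set s := √((k : ℝ) * r) with hs
  have hs1 : 1 ≤ s := by rw [hs, Real.one_le_sqrt]; exact hkr
  have hs0 : 0 < s := by linarith
  have hk1 : (1 : ℝ) ≤ k := by nlinarith
  have hk0 : 0 < k := by exact_mod_cast hk1
  have hN0 : 0 < N := by omega
  have hNr : (0 : ℝ) < N := by positivity
  set J := (Finset.range (k + 1)).filter fun j : ℕ => |(k : ℝ) / 2 - (j : ℕ)| ≤ 4 * s with hJ
  have hcard : (J.card : ℝ) ≤ 9 * s :=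
    (card_filter_abs_sub_le (k + 1) ((k : ℝ) / 2) (by positivity)).trans (by linarith)
  have hT4 : (k : ℝ) ^ 3 / N ^ 2 ≤ T := by rw [div_le_iff₀ (by positivity)]; exact hT
  have hweight : ∀ j ∈ J, (N : ℝ) ^ (k + 1) * Real.exp (-(4 + 6 * T)) ≤
      ((N - j).ascFactorial (k + 1) : ℝ) := by
    intro j hj
    obtain ⟨hj1, hj2⟩ := Finset.mem_filter.1 hj
    have hj1' : j ≤ k := by have := Finset.mem_range.1 hj1; omega
    refine le_trans ?_ (le_ascFactorial_sub hj1' hN hN0)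
    gcongr
    have h1 : ((k : ℝ) + 1) * (k / N) ^ 2 ≤ 2 * T := by
      calc ((k : ℝ) + 1) * ((k : ℝ) / N) ^ 2 ≤ (2 * k) * ((k : ℝ) / N) ^ 2 := by gcongr; linarith
        _ = 2 * ((k : ℝ) ^ 3 / N ^ 2) := by field_simp
        _ ≤ _ := by linarith
    -- At distance 4s from the centre the linear exponent is at most 8y with y = (k / N)√k and y² ≤
    -- T; then 8y ≤ 4 + 4y².
    have h2 : ((k : ℝ) + 1) / N * (4 * s) ≤ 4 + 4 * T := by
      have h3 : ((k : ℝ) + 1) / N * (4 * s) ≤ (2 * k) / N * (4 * √k) := by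
        gcongr
        · linarith
        · rw [hs]; exact Real.sqrt_le_sqrt (by nlinarith)
      have h4 : (k / N * √k) ^ 2 ≤ T := by
        refine le_trans (le_of_eq ?_) hT4
        rw [mul_pow, Real.sq_sqrt (by positivity), div_pow]; ring
      have h5 : (2 * k) / N * (4 * √k) = 8 * (k / N * √k) := by ring
      nlinarith [sq_nonneg (k / N * √k - 1)]
    have h3 := (abs_le.1 hj2).1
    have h4 : ((k : ℝ) + 1) / N * (-(4 * s)) ≤ ((k : ℝ) + 1) / N * ((k : ℝ) / 2 - j) :=
      mul_le_mul_of_nonneg_left h3 (by positivity)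
    linarith
  have hsq : ((1 + r) ^ k / 2) ^ 2 ≤ 9 * s * ∑ j ∈ J, (connPoly r n m).coeff j ^ 2 := by
    calc ((1 + r) ^ k / 2) ^ 2 ≤ (∑ j ∈ J, (connPoly r n m).coeff j) ^ 2 := by gcongr
      _ ≤ J.card * ∑ j ∈ J, (connPoly r n m).coeff j ^ 2 := sq_sum_le_card_mul_sum_sq
      _ ≤ _ := by gcongr
  have hlow : ∑ j ∈ J, (connPoly r n m).coeff j ^ 2 * ((N : ℝ) ^ (k + 1) * Real.exp (-(4 + 6 * T)))
      ≤ weightedSum r n m N := by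
    refine (Finset.sum_le_sum fun j hj => mul_le_mul_of_nonneg_left (hweight j hj)
      (sq_nonneg _)).trans ?_
    refine Finset.sum_le_sum_of_subset_of_nonneg (Finset.filter_subset _ _) fun j _ _ => ?_
    positivity
  rw [← Finset.sum_mul] at hlow
  refine le_trans ?_ hlow
  have hS : (1 + r) ^ (2 * k) / (36 * s) ≤ ∑ j ∈ J, (connPoly r n m).coeff j ^ 2 := by
    rw [div_le_iff₀ (by positivity)]
    have : (1 + r) ^ (2 * k) = ((1 + r) ^ k) ^ 2 := by rw [← pow_mul]; ring
    rw [this]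
    linarith [hsq]
  calc _ = (1 + r) ^ (2 * k) / (36 * s) * ((N : ℝ) ^ (k + 1) * Real.exp (-(4 + 6 * T))) := by
        field_simp
    _ ≤ _ := by gcongr


/-! ### Meixner polynomials by generating series, and their orthogonality -/

theorem hasSum_of_eq {f g : ℕ → ℝ} {a b : ℝ} (h : HasSum f a) (hf : ∀ z, g z = f z)
    (hb : b = a) : HasSum g b := by
  rw [hb, funext hf]; exact h

/-- The geometric power series `1 / (1 - q * X)`. -/
def geomSeries (q : ℝ) : PowerSeries ℝ := PowerSeries.mk fun n => q ^ n

theorem geomSeries_eq_rescale (q : ℝ) :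
    geomSeries q = PowerSeries.rescale q (PowerSeries.mk 1) := by
  ext n; simp [geomSeries, PowerSeries.coeff_rescale]

theorem geomSeries_mul (q : ℝ) :
    (1 - PowerSeries.C q * PowerSeries.X) * geomSeries q = 1 := by
  have h := congrArg (PowerSeries.rescale q) (PowerSeries.mk_one_mul_one_sub_eq_one ℝ)
  rw [map_mul, map_sub, map_one, PowerSeries.rescale_X, ← geomSeries_eq_rescale] at h
  rw [mul_comm, h]

theorem geomSeries_one_mul : (1 - PowerSeries.X) * geomSeries 1 = 1 := by
  simpa using geomSeries_mul 1

theorem coeff_geomSeries_pow (q : ℝ) (d n : ℕ) :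
    PowerSeries.coeff n (geomSeries q ^ (d + 1)) = q ^ n * (d + n).choose d := by
  rw [geomSeries_eq_rescale, ← map_pow, PowerSeries.mk_one_pow_eq_mk_choose_add,
    PowerSeries.coeff_rescale, PowerSeries.coeff_mk]

/-- The generating series `(1 - X) ^ z / (1 - q * X) ^ (z + k + 1)` of the Meixner polynomials
with parameter `k + 1`, evaluated at `z`. -/
def genSeries (q : ℝ) (k z : ℕ) : PowerSeries ℝ :=
  (1 - PowerSeries.X) ^ z * geomSeries q ^ (z + k + 1)

/-- The value at `z` of the `l`-th Meixner polynomial with parameter `k + 1`. -/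
def meixnerVal (q : ℝ) (k l z : ℕ) : ℝ := PowerSeries.coeff l (genSeries q k z)

theorem coeff_C_mul_X_pow_mul_geomSeries (q c : ℝ) {a l : ℕ} (k : ℕ) (h : a ≤ l) :
    PowerSeries.coeff l (PowerSeries.C c * PowerSeries.X ^ a * geomSeries q ^ (a + k + 1)) =
      c * (q ^ (l - a) * (l + k).choose (k + a)) := by
  rw [mul_assoc, PowerSeries.coeff_C_mul, PowerSeries.coeff_X_pow_mul', if_pos h,
    coeff_geomSeries_pow]
  congr 4 <;> omega

/-- Expansion of the Meixner polynomials in binomial coefficients. -/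
theorem meixnerVal_eq_sum (q : ℝ) (k l z : ℕ) :
    meixnerVal q k l z = ∑ a ∈ Finset.range (l + 1),
      (z.choose a : ℝ) * (-(1 - q)) ^ a * q ^ (l - a) * (l + k).choose (k + a) := by
  -- The quotient (1 - X) / (1 - qX) equals 1 - (1 - q) X / (1 - qX); its z-th power is expanded
  -- binomially.
  have h1 : (1 - PowerSeries.X) * geomSeries q =
      PowerSeries.C (-(1 - q)) * PowerSeries.X * geomSeries q + 1 := by
    have := geomSeries_mul q
    simp only [map_neg, map_sub, map_one]
    linear_combination this
  have h2 : genSeries q k z = ∑ a ∈ Finset.range (z + 1),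
      PowerSeries.C ((z.choose a : ℝ) * (-(1 - q)) ^ a) * PowerSeries.X ^ a *
        geomSeries q ^ (a + k + 1) := by
    have : genSeries q k z = ((1 - PowerSeries.X) * geomSeries q) ^ z * geomSeries q ^ (k + 1) := by
      rw [genSeries, mul_pow, add_assoc, pow_add]; ring
    rw [this, h1, add_pow, Finset.sum_mul]
    refine Finset.sum_congr rfl fun a _ => ?_
    simp only [map_mul, map_pow, map_natCast]
    ring
  rw [meixnerVal, h2, map_sum]
  have h3 : ∀ a, PowerSeries.coeff l (PowerSeries.C ((z.choose a : ℝ) * (-(1 - q)) ^ a) *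
      PowerSeries.X ^ a * geomSeries q ^ (a + k + 1)) =
      (z.choose a : ℝ) * (-(1 - q)) ^ a * q ^ (l - a) * (l + k).choose (k + a) := by
    intro a
    rcases le_or_gt a l with h | h
    · rw [coeff_C_mul_X_pow_mul_geomSeries q _ k h]; ring
    · rw [Nat.choose_eq_zero_of_lt (show l + k < k + a by omega), mul_assoc,
        PowerSeries.coeff_C_mul, PowerSeries.coeff_X_pow_mul', if_neg (by omega)]
      simp
  simp only [h3]
  have h4 : ∀ s t : ℕ, (∀ a, s ≤ a → (z.choose a : ℝ) * (-(1 - q)) ^ a * q ^ (l - a) *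
      (l + k).choose (k + a) = 0) → ∑ a ∈ Finset.range s, (z.choose a : ℝ) * (-(1 - q)) ^ a *
        q ^ (l - a) * (l + k).choose (k + a) = ∑ a ∈ Finset.range (max s t),
      (z.choose a : ℝ) * (-(1 - q)) ^ a * q ^ (l - a) * (l + k).choose (k + a) := by
    intro s t h
    refine Finset.sum_subset (by intro i; simp; omega) fun a _ ha => h a ?_
    simpa using ha
  rw [h4 (z + 1) (l + 1), h4 (l + 1) (z + 1), max_comm]
  · intro a ha
    rw [Nat.choose_eq_zero_of_lt (show l + k < k + a by omega)]; simp
  · intro a ha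
    rw [Nat.choose_eq_zero_of_lt (show z < a by omega)]; simp

/-- By Pascal's rule, multiplying the truncated series of (1 + U) ^ (-(d + 2)) by 1 + U gives the
truncated series of (1 + U) ^ (-(d + 1)), with an explicit remainder divisible by U ^ (l + 1). -/
theorem sum_choose_mul_neg_pow_mul_one_add {R : Type*} [CommRing R] (U : R) (d l : ℕ) :
    (∑ i ∈ Finset.range (l + 1), ((d + 1 + i).choose (d + 1) : R) * (-U) ^ i) * (1 + U) =
      ∑ i ∈ Finset.range (l + 1), ((d + i).choose d : R) * (-U) ^ i +
        (d + 1 + l).choose (d + 1) * (-U) ^ l * U := by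
  induction l with
  | zero => simp
  | succ l ih =>
    rw [Finset.sum_range_succ, add_mul, ih,
      Finset.sum_range_succ (fun i => ((d + i).choose d : R) * (-U) ^ i) (l + 1)]
    have h : ((d + 1 + (l + 1)).choose (d + 1) : R) =
        (d + (l + 1)).choose d + (d + 1 + l).choose (d + 1) := by
      rw [show d + 1 + (l + 1) = d + (l + 1) + 1 by ring, Nat.choose_succ_succ,
        show d + (l + 1) = d + 1 + l by ring]
      push_cast; ring
    rw [h]; ring

/-- The truncated negative binomial series inverts (1 + U) ^ (d + 1) modulo U ^ (l + 1). For a power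
series U divisible by X this determines coefficients up to X ^ l without substituting into a series.
-/
theorem exists_sum_choose_mul_neg_pow_eq {R : Type*} [CommRing R] (U : R) (d l : ℕ) :
    ∃ Y, (∑ i ∈ Finset.range (l + 1), ((d + i).choose d : R) * (-U) ^ i) * (1 + U) ^ (d + 1) =
      1 + U ^ (l + 1) * Y := by
  induction d with
  | zero =>
    refine ⟨-(-1) ^ (l + 1), ?_⟩
    have := geom_sum_mul (-U) (l + 1)
    simp only [Nat.zero_add, Nat.choose_zero_right, Nat.cast_one, one_mul, pow_one]
    have h2 : (-U) ^ (l + 1) = (-1) ^ (l + 1) * U ^ (l + 1) := neg_pow U _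
    linear_combination (-1 : R) * this - h2
  | succ d ih =>
    obtain ⟨Y, hY⟩ := ih
    refine ⟨Y + (d + 1 + l).choose (d + 1) * (-1) ^ l * (1 + U) ^ (d + 1), ?_⟩
    rw [pow_succ' _ (d + 1), ← mul_assoc, sum_choose_mul_neg_pow_mul_one_add, add_mul, hY,
      neg_pow U l]
    ring

/-- Expansion of the Meixner polynomials in rising binomial coefficients. -/
theorem meixnerVal_eq_sum_rising (q : ℝ) (k l z : ℕ) :
    meixnerVal q k l z = ∑ i ∈ Finset.range (l + 1),
      ((z + k + i).choose (z + k) : ℝ) * (-(1 - q)) ^ i * (l + k).choose (k + i) := by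
  set E := geomSeries 1 with hE
  set U : PowerSeries ℝ := PowerSeries.C (1 - q) * PowerSeries.X * E with hU
  obtain ⟨Y, hY⟩ := exists_sum_choose_mul_neg_pow_eq U (z + k) l
  have hXE : (1 - PowerSeries.X) * E = 1 := geomSeries_one_mul
  have hV := geomSeries_mul q
  -- Here 1 + U = (1 - qX) / (1 - X), so the generating series is E ^ (k + 1) (1 + U) ^ (-(z + k +
  -- 1)).
  have hU1 : 1 + U = (1 - PowerSeries.C q * PowerSeries.X) * E := by
    rw [hU]
    simp only [map_sub, map_one]
    linear_combination (-1 : PowerSeries ℝ) * hXE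
  have hG : genSeries q k z * (1 + U) ^ (z + k + 1) = E ^ (k + 1) := by
    calc _ = ((1 - PowerSeries.X) * E) ^ z *
        ((1 - PowerSeries.C q * PowerSeries.X) * geomSeries q) ^ (z + k + 1) * E ^ (k + 1) := by
          rw [genSeries, hU1, mul_pow, mul_pow, mul_pow, add_assoc, pow_add E]; ring
      _ = _ := by rw [hXE, hV]; simp
  set S := ∑ i ∈ Finset.range (l + 1), ((z + k + i).choose (z + k) : PowerSeries ℝ) * (-U) ^ i
  have hGS : genSeries q k z = S * E ^ (k + 1) -
      PowerSeries.X ^ (l + 1) * (PowerSeries.C (1 - q) ^ (l + 1) * E ^ (l + 1) * Y *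
        genSeries q k z) := by
    have : U ^ (l + 1) = PowerSeries.X ^ (l + 1) * (PowerSeries.C (1 - q) ^ (l + 1) *
      E ^ (l + 1)) := by rw [hU, mul_pow, mul_pow]; ring
    rw [← hG]
    linear_combination (-genSeries q k z) * hY + (-genSeries q k z * Y) * this
  rw [meixnerVal, hGS, map_sub, PowerSeries.coeff_X_pow_mul', if_neg (by omega), sub_zero,
    Finset.sum_mul, map_sum]
  refine Finset.sum_congr rfl fun i hi => ?_
  have hi' : i ≤ l := by have := Finset.mem_range.1 hi; omega
  have : ((z + k + i).choose (z + k) : PowerSeries ℝ) * (-U) ^ i * E ^ (k + 1) =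
      PowerSeries.C (((z + k + i).choose (z + k) : ℝ) * (-(1 - q)) ^ i) * PowerSeries.X ^ i *
        E ^ (i + k + 1) := by
    have h : -U = PowerSeries.C (-(1 - q)) * PowerSeries.X * E := by
      rw [hU, map_neg]; ring
    rw [h, mul_pow, mul_pow, map_mul, map_pow, map_natCast, add_assoc i k 1, pow_add E i]
    ring
  rw [this, coeff_C_mul_X_pow_mul_geomSeries 1 _ k hi']
  simp

theorem hasSum_choose_mul_choose_mul_pow {q : ℝ} (h0 : 0 ≤ q) (h1 : q < 1) (K a : ℕ) :
    HasSum (fun z : ℕ => ((z + K).choose K : ℝ) * q ^ z * z.choose a)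
      ((a + K).choose a * (q ^ a / (1 - q) ^ (a + K + 1))) := by
  have hn : ‖q‖ < 1 := by rwa [Real.norm_eq_abs, abs_of_nonneg h0]
  have h := ((hasSum_choose_mul_geometric_of_norm_lt_one (a + K) hn).mul_left
    (q ^ a * (a + K).choose a))
  rw [← hasSum_nat_add_iff' a, Finset.sum_eq_zero, sub_zero]
  · refine hasSum_of_eq h (fun w => ?_) ?_
    · have e : ((w + a + K).choose K : ℝ) * (w + a).choose a =
          (a + K).choose a * (w + (a + K)).choose (a + K) := by
        have := Nat.choose_mul (n := w + a + K) (k := a + K) (s := K) (by omega)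
        rw [show w + a + K - K = w + a by omega, show a + K - K = a by omega,
          ← Nat.choose_symm_add (a := a) (b := K)] at this
        rw [show w + (a + K) = w + a + K by ring]
        have h2 : ((w + a + K).choose (a + K) : ℝ) * (a + K).choose a =
            (w + a + K).choose K * (w + a).choose a := by exact_mod_cast this
        linarith
      rw [pow_add]
      linear_combination (q ^ w * q ^ a) * e
    · ring
  · intro i hi
    rw [Nat.choose_eq_zero_of_lt (Finset.mem_range.1 hi)]; simp

/-- The alternating Vandermonde-type sum behind the orthogonality relations. -/
theorem sum_neg_one_pow_mul_choose {k i l : ℕ} (hil : i ≤ l) :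
    ∑ a ∈ Finset.range (l + 1), (-1 : ℝ) ^ a * (l + k).choose (k + a) *
      (a + (k + i)).choose a = if i = l then (-1) ^ l else 0 := by
  have hX : ((1 - PowerSeries.X : PowerSeries ℝ)) ^ (l + k) =
      ∑ b ∈ Finset.range (l + k + 1),
        PowerSeries.C ((-1 : ℝ) ^ b * (l + k).choose b) * PowerSeries.X ^ b := by
    rw [sub_eq_neg_add, add_pow]
    refine Finset.sum_congr rfl fun b _ => ?_
    rw [neg_pow]
    simp
    ring
  -- The sum is, up to sign, the X ^ l coefficient of (1 - X) ^ (l + k) / (1 - X) ^ (k + i + 1). For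
  -- i < l this is a polynomial of degree l - i - 1 < l; for i = l it is 1 / (1 - X).
  have hL : PowerSeries.coeff l (((1 - PowerSeries.X : PowerSeries ℝ)) ^ (l + k) *
      geomSeries 1 ^ (k + i + 1)) = if i = l then 1 else 0 := by
    have hXE := geomSeries_one_mul
    split_ifs with h
    · subst h
      rw [pow_succ, ← mul_assoc, add_comm i k, ← mul_pow, hXE, one_pow, one_mul]
      simp [geomSeries]
    · obtain ⟨d, rfl⟩ : ∃ d, l = d + 1 + i := ⟨l - i - 1, by omega⟩
      have : (1 - PowerSeries.X : PowerSeries ℝ) ^ (d + 1 + i + k) * geomSeries 1 ^ (k + i + 1) =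
          (1 - PowerSeries.X) ^ d := by
        rw [show d + 1 + i + k = d + (k + i + 1) by ring, pow_add, mul_assoc, ← mul_pow, hXE]
        simp
      have h2 : ((1 - PowerSeries.X : PowerSeries ℝ)) ^ d =
          (((1 - X : ℝ[X]) ^ d : ℝ[X]) : PowerSeries ℝ) := by simp
      rw [this, h2, Polynomial.coeff_coe]
      refine Polynomial.coeff_eq_zero_of_natDegree_lt ?_
      refine lt_of_le_of_lt (natDegree_pow_le_of_le d (m := 1) ?_) (by omega)
      compute_degree
  have hR : PowerSeries.coeff l (((1 - PowerSeries.X : PowerSeries ℝ)) ^ (l + k) *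
      geomSeries 1 ^ (k + i + 1)) = ∑ b ∈ Finset.range (l + 1),
        (-1 : ℝ) ^ b * (l + k).choose b * (k + i + (l - b)).choose (k + i) := by
    have hp : (1 - PowerSeries.X : PowerSeries ℝ) ^ (l + k) =
        (((1 - X : ℝ[X]) ^ (l + k) : ℝ[X]) : PowerSeries ℝ) := by simp
    have hc : ∀ b, ((1 - X : ℝ[X]) ^ (l + k)).coeff b = (-1 : ℝ) ^ b * (l + k).choose b := by
      intro b
      have := coeff_one_add_C_mul_X_pow (-1) (l + k) b
      rw [mul_comm, ← this]
      congr 2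
      simp [sub_eq_add_neg]
    rw [hp, PowerSeries.coeff_mul,
      Finset.Nat.sum_antidiagonal_eq_sum_range_succ_mk]
    refine Finset.sum_congr rfl fun b _ => ?_
    rw [Polynomial.coeff_coe, hc, coeff_geomSeries_pow, one_pow, one_mul]
  rw [← Finset.sum_range_reflect]
  have : ∀ b ∈ Finset.range (l + 1), (-1 : ℝ) ^ (l + 1 - 1 - b) *
      (l + k).choose (k + (l + 1 - 1 - b)) * (l + 1 - 1 - b + (k + i)).choose (l + 1 - 1 - b) =
      (-1) ^ l * ((-1 : ℝ) ^ b * (l + k).choose b * (k + i + (l - b)).choose (k + i)) := by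
    intro b hb
    have hb' : b ≤ l := by have := Finset.mem_range.1 hb; omega
    obtain ⟨d, rfl⟩ := Nat.exists_eq_add_of_le hb'
    rw [show b + d + 1 - 1 - b = d by omega, show b + d - b = d by omega,
      show (b + d + k).choose (k + d) = (b + d + k).choose b by
        rw [← Nat.choose_symm_of_eq_add]; ring,
      show (d + (k + i)).choose d = (k + i + d).choose (k + i) by
        rw [add_comm d]; exact (Nat.choose_symm_add).symm, pow_add]
    have : ((-1 : ℝ) ^ b) * (-1) ^ b = 1 := by rw [← mul_pow]; simp
    linear_combination (-(-1 : ℝ) ^ d * (b + d + k).choose b * (k + i + d).choose (k + i)) * this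
  rw [Finset.sum_congr rfl this, ← Finset.mul_sum, ← hR, hL]
  split_ifs <;> simp

/-- The weight of parameter k + i + 1 is that of parameter k + 1 times a rising binomial of degree
i, up to a constant. So this is orthogonality to lower degrees, tested against the falling
expansion, whose terms are factorial moments of a negative binomial law. -/
theorem hasSum_rising_mul_meixnerVal {q : ℝ} (h0 : 0 < q) (h1 : q < 1) {k i l : ℕ} (hil : i ≤ l) :
    HasSum (fun z : ℕ => ((z + (k + i)).choose (k + i) : ℝ) * q ^ z * meixnerVal q k l z)
      (if i = l then (-1) ^ l * q ^ l / (1 - q) ^ (k + l + 1) else 0) := by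
  have h1' : 0 < 1 - q := by linarith
  have h := hasSum_sum (s := Finset.range (l + 1)) fun a _ =>
    (hasSum_choose_mul_choose_mul_pow h0.le h1 (k + i) a).mul_left
      ((-(1 - q)) ^ a * q ^ (l - a) * (l + k).choose (k + a))
  refine hasSum_of_eq h (fun z => ?_) ?_
  · rw [meixnerVal_eq_sum, Finset.mul_sum]
    refine Finset.sum_congr rfl fun a _ => ?_
    ring
  · have : ∀ a ∈ Finset.range (l + 1), (-(1 - q)) ^ a * q ^ (l - a) * (l + k).choose (k + a) *
        ((a + (k + i)).choose a * (q ^ a / (1 - q) ^ (a + (k + i) + 1))) =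
        q ^ l / (1 - q) ^ (k + i + 1) *
          ((-1 : ℝ) ^ a * (l + k).choose (k + a) * (a + (k + i)).choose a) := by
      intro a ha
      have ha' : a ≤ l := by have := Finset.mem_range.1 ha; omega
      have e : q ^ l = q ^ (l - a) * q ^ a := by rw [← pow_add]; congr 1; omega
      rw [e, neg_pow, add_assoc a, pow_add _ a]
      field_simp
    rw [Finset.sum_congr rfl this, ← Finset.mul_sum, sum_neg_one_pow_mul_choose hil]
    split_ifs with h
    · rw [h]; ring
    · simp

/-- Expanding the lower-degree factor in rising binomials, each of which merges with the weight,
leaves only the term i = l, present only when j = l. -/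
theorem hasSum_meixnerVal_mul_of_le {q : ℝ} (h0 : 0 < q) (h1 : q < 1) {k j l : ℕ} (hjl : j ≤ l) :
    HasSum (fun z : ℕ => ((z + k).choose k : ℝ) * q ^ z * (meixnerVal q k j z * meixnerVal q k l z))
      (if j = l then (k + l).choose k * q ^ l / (1 - q) ^ (k + 1) else 0) := by
  have h1' : 0 < 1 - q := by linarith
  have h := hasSum_sum (s := Finset.range (j + 1)) fun i hi =>
    (hasSum_rising_mul_meixnerVal h0 h1 (k := k) (i := i) (l := l)
      (by have := Finset.mem_range.1 hi; omega)).mul_left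
      ((-(1 - q)) ^ i * (j + k).choose (k + i) * (k + i).choose i)
  refine hasSum_of_eq h (fun z => ?_) ?_
  · rw [meixnerVal_eq_sum_rising q k j z, Finset.sum_mul, Finset.mul_sum]
    refine Finset.sum_congr rfl fun i _ => ?_
    have e : ((z + k).choose k : ℝ) * (z + k + i).choose (z + k) =
        (k + i).choose i * (z + (k + i)).choose (k + i) := by
      have := Nat.choose_mul (n := z + k + i) (k := k + i) (s := i) (by omega)
      rw [show z + k + i - i = z + k by omega, show k + i - i = k by omega,
        show (z + k + i).choose i = (z + k + i).choose (z + k) from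
          (Nat.choose_symm_add).symm] at this
      rw [← add_assoc]
      have h2 : ((z + k + i).choose (k + i) : ℝ) * (k + i).choose i =
        (z + k + i).choose (z + k) * (z + k).choose k := by exact_mod_cast this
      linarith
    linear_combination (q ^ z * (-(1 - q)) ^ i * (j + k).choose (k + i) * meixnerVal q k l z) * e
  · split_ifs with hj
    · subst hj
      rw [Finset.sum_eq_single_of_mem j (by simp)]
      · rw [if_pos rfl, add_comm j k, Nat.choose_self, ← Nat.choose_symm_add, neg_pow]
        have : ((-1 : ℝ) ^ j) * (-1) ^ j = 1 := by rw [← mul_pow]; simp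
        have e : (-1 : ℝ) ^ j * (1 - q) ^ j * ((k + j).choose (k + j) : ℝ) *
            ((k + j).choose k) * ((-1) ^ j * q ^ j / (1 - q) ^ (k + j + 1)) =
            ((-1) ^ j * (-1) ^ j) * ((k + j).choose k * q ^ j / (1 - q) ^ (k + 1)) := by
          rw [Nat.choose_self, show k + j + 1 = j + (k + 1) by ring, pow_add _ j]
          field_simp
          simp
        rw [this, one_mul] at e
        rw [← e]
        simp
      · intro b _ hb; rw [if_neg hb]; simp
    · rw [Finset.sum_eq_zero]
      intro b hb
      rw [if_neg (by have := Finset.mem_range.1 hb; omega)]; simp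

/-- Orthogonality of the Meixner polynomials. -/
theorem hasSum_meixnerVal_mul {q : ℝ} (h0 : 0 < q) (h1 : q < 1) (k j l : ℕ) :
    HasSum (fun z : ℕ => ((z + k).choose k : ℝ) * q ^ z * (meixnerVal q k j z * meixnerVal q k l z))
      (if j = l then (k + l).choose k * q ^ l / (1 - q) ^ (k + 1) else 0) := by
  rcases le_total j l with h | h
  · exact hasSum_meixnerVal_mul_of_le h0 h1 h
  · refine hasSum_of_eq (hasSum_meixnerVal_mul_of_le h0 h1 h (k := k)) (fun z => ?_) ?_
    · ring
    · by_cases hjl : j = l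
      · rw [if_pos hjl, if_pos hjl.symm, hjl]
      · rw [if_neg hjl, if_neg (Ne.symm hjl)]

/-! ### Change of parameter and weighted second moments -/

/-- The connection formula between Meixner polynomials of parameters `1` and `n + m + 1`. -/
theorem meixnerVal_zero_add (q : ℝ) (n m l z : ℕ) :
    meixnerVal q 0 l (z + n) = ∑ j ∈ Finset.range (l + 1),
      ((1 - X : ℝ[X]) ^ n * (1 - C q * X) ^ m).coeff j * meixnerVal q (n + m) (l - j) z := by
  have hV := geomSeries_mul q
  have h : genSeries q 0 (z + n) =
      (((1 - X : ℝ[X]) ^ n * (1 - C q * X) ^ m : ℝ[X]) : PowerSeries ℝ) *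
        genSeries q (n + m) z := by
    have : geomSeries q ^ (z + n + 0 + 1) = ((1 - PowerSeries.C q * PowerSeries.X) *
        geomSeries q) ^ m * geomSeries q ^ (z + n + 0 + 1) := by rw [hV]; simp
    rw [genSeries, genSeries, this, mul_pow, pow_add _ z n]
    have e : z + (n + m) + 1 = m + (z + n + 0 + 1) := by ring
    rw [e, pow_add _ m]
    simp
    ring
  rw [meixnerVal, h, PowerSeries.coeff_mul, Finset.Nat.sum_antidiagonal_eq_sum_range_succ_mk]
  simp only [Polynomial.coeff_coe, meixnerVal]

/-- Substituting -rX for X in `connPoly` gives r ^ n (1 - X) ^ n (1 - r²X) ^ m. The signs disappear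
on squaring, and the powers of r cancel against the squared norms in the second-moment formula. -/
theorem coeff_connPoly_eq {r : ℝ} (n m j : ℕ) :
    r ^ n * ((1 - X : ℝ[X]) ^ n * (1 - C (r ^ 2) * X) ^ m).coeff j =
      (-r) ^ j * (connPoly r n m).coeff j := by
  have h : C (r ^ n) * ((1 - X : ℝ[X]) ^ n * (1 - C (r ^ 2) * X) ^ m) =
      (connPoly r n m).comp (C (-r) * X) := by
    simp only [connPoly, mul_comp, pow_comp, add_comp, C_comp, X_comp, one_comp, map_neg, map_pow]
    rw [← mul_assoc, ← mul_pow]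
    congr 2 <;> ring
  rw [← Polynomial.coeff_C_mul, h, Polynomial.comp_C_mul_X_coeff, mul_comm]

/-- The second moments of the Meixner polynomials weighted by a binomial coefficient. -/
theorem hasSum_choose_mul_meixnerVal_sq {r : ℝ} (h0 : 0 < r) (h1 : r < 1) (n m l : ℕ) :
    HasSum (fun x : ℕ => ((x + m).choose (n + m) : ℝ) *
        ((1 - r ^ 2) * (r ^ 2) ^ x * (meixnerVal (r ^ 2) 0 l x ^ 2 / (r ^ 2) ^ l)))
      (((1 - r ^ 2) ^ (n + m))⁻¹ * ∑ j ∈ Finset.range (l + 1),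
        (connPoly r n m).coeff j ^ 2 * ((n + m + (l - j)).choose (n + m) : ℝ)) := by
  set q := r ^ 2 with hq
  have hq0 : 0 < q := by positivity
  have hq1 : q < 1 := by rw [hq]; nlinarith
  have hq1' : 0 < 1 - q := by linarith
  set e : ℕ → ℝ := fun j => ((1 - X : ℝ[X]) ^ n * (1 - C q * X) ^ m).coeff j with he
  have h := hasSum_sum (s := Finset.range (l + 1)) fun i _ =>
    hasSum_sum (s := Finset.range (l + 1)) fun j _ =>
    (hasSum_meixnerVal_mul hq0 hq1 (n + m) (l - i) (l - j)).mul_left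
      ((1 - q) * q ^ n / q ^ l * (e i * e j))
  -- The binomial weight vanishes for x < n; at x = z + n it is C(z + k, k) with k = n + m, the
  -- orthogonality weight of the new parameter.
  rw [← hasSum_nat_add_iff' n, Finset.sum_eq_zero (s := Finset.range n), sub_zero]
  · refine hasSum_of_eq h (fun z => ?_) ?_
    · rw [meixnerVal_zero_add q n m, sq, Finset.sum_mul_sum, Finset.sum_div, Finset.mul_sum,
        Finset.mul_sum]
      refine Finset.sum_congr rfl fun i _ => ?_
      rw [Finset.sum_div, Finset.mul_sum, Finset.mul_sum]
      refine Finset.sum_congr rfl fun j _ => ?_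
      simp only [he]
      rw [show z + n + m = z + (n + m) by ring, pow_add]
      ring
    · rw [Finset.mul_sum]
      refine Finset.sum_congr rfl fun i hi => ?_
      have hi' : i ≤ l := by have := Finset.mem_range.1 hi; omega
      rw [Finset.sum_eq_single_of_mem i hi]
      · rw [if_pos rfl]
        have hc := coeff_connPoly_eq (r := r) n m i
        change r ^ n * e i = _ at hc
        have hc2 : q ^ n * e i ^ 2 = q ^ i * (connPoly r n m).coeff i ^ 2 := by
          have e1 : q ^ n = (r ^ n) ^ 2 := by rw [hq, ← pow_mul, ← pow_mul, mul_comm]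
          have e2 : q ^ i = ((-r) ^ i) ^ 2 := by
            rw [pow_right_comm (-r), neg_sq]
          rw [e1, e2, ← mul_pow, ← mul_pow, hc]
        have e3 : q ^ l = q ^ (l - i) * q ^ i := by rw [← pow_add]; congr 1; omega
        have hc3 : (connPoly r n m).coeff i ^ 2 = q ^ n * e i ^ 2 / q ^ i := by
          rw [hc2]; field_simp
        rw [hc3, e3, pow_succ (1 - q)]
        field_simp
      · intro b hb hbi
        have := Finset.mem_range.1 hb
        rw [if_neg (by omega)]; simp
  · intro i hi
    rw [Nat.choose_eq_zero_of_lt (by have := Finset.mem_range.1 hi; omega)]; simp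

/-! ### Three-term recurrence and the Meixner polynomials as elements of ℝ[X] -/

theorem one_sub_X_mul_derivative_pow (z : ℕ) :
    (1 - PowerSeries.X) * PowerSeries.derivative ℝ ((1 - PowerSeries.X) ^ z) =
      -(z : PowerSeries ℝ) * (1 - PowerSeries.X) ^ z := by
  rw [PowerSeries.derivative_pow]
  cases z with
  | zero => simp
  | succ z =>
    rw [map_sub, PowerSeries.derivative_X]
    simp [pow_succ]
    ring

theorem derivative_geomSeries (q : ℝ) :
    (1 - PowerSeries.C q * PowerSeries.X) * PowerSeries.derivative ℝ (geomSeries q) =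
      PowerSeries.C q * geomSeries q := by
  have h := congrArg (PowerSeries.derivative ℝ) (geomSeries_mul q)
  rw [Derivation.leibniz] at h
  simp only [smul_eq_mul, map_sub, Derivation.leibniz, PowerSeries.derivative_X,
    PowerSeries.derivative_C, Derivation.map_one_eq_zero] at h
  linear_combination h

/-- This is the logarithmic derivative of (1 - X) ^ z / (1 - qX) ^ (z + 1) with denominators
cleared; comparing coefficients yields the recurrence. -/
theorem derivative_genSeries (q : ℝ) (z : ℕ) :
    (1 - PowerSeries.X) * (1 - PowerSeries.C q * PowerSeries.X) *
        PowerSeries.derivative ℝ (genSeries q 0 z) =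
      (-(z : PowerSeries ℝ) * (1 - PowerSeries.C q * PowerSeries.X) +
        PowerSeries.C q * ((z : PowerSeries ℝ) + 1) * (1 - PowerSeries.X)) * genSeries q 0 z := by
  have h1 := one_sub_X_mul_derivative_pow z
  have h2 := derivative_geomSeries q
  rw [genSeries, Derivation.leibniz, PowerSeries.derivative_pow (geomSeries q)]
  simp only [smul_eq_mul, add_zero, Nat.add_sub_cancel]
  push_cast
  linear_combination (1 - PowerSeries.C q * PowerSeries.X) * geomSeries q ^ (z + 1) * h1 +
    (1 - PowerSeries.X) * (1 - PowerSeries.X) ^ z * (z + 1) * geomSeries q ^ z * h2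

/-- The three-term recurrence of the Meixner polynomials. -/
theorem meixnerVal_recurrence (q : ℝ) (l z : ℕ) :
    ((l : ℝ) + 2) * meixnerVal q 0 (l + 2) z =
      ((q - 1) * z + (l + 1) + (l + 2) * q) * meixnerVal q 0 (l + 1) z -
        q * (l + 1) * meixnerVal q 0 l z := by
  have h := derivative_genSeries q z
  set G := genSeries q 0 z with hG
  set D := PowerSeries.derivative ℝ G with hD
  have h' : D = PowerSeries.C (1 + q) * (D * PowerSeries.X) -
      PowerSeries.C q * (D * PowerSeries.X ^ 2) + PowerSeries.C (q * (z + 1) - z) * G -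
      PowerSeries.C q * (G * PowerSeries.X) := by
    simp only [map_add, map_sub, map_mul, map_one, map_natCast]
    linear_combination h
  have hc := congrArg (PowerSeries.coeff (l + 1)) h'
  have hX2 : PowerSeries.coeff (l + 1) (D * PowerSeries.X ^ 2) = l * PowerSeries.coeff l G := by
    cases l with
    | zero => rw [PowerSeries.coeff_mul_X_pow']; simp
    | succ l =>
      rw [show l + 1 + 1 = l + 2 by ring, PowerSeries.coeff_mul_X_pow, hD, PowerSeries.coeff_derivative]
      push_cast; ring
  simp only [map_add (PowerSeries.coeff (l + 1)), map_sub (PowerSeries.coeff (l + 1)),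
    PowerSeries.coeff_C_mul, PowerSeries.coeff_succ_mul_X, hX2] at hc
  simp only [hD, PowerSeries.coeff_derivative] at hc
  simp only [meixnerVal, ← hG]
  push_cast at hc
  rw [show l + 1 + 1 = l + 2 by ring] at hc
  linear_combination hc

theorem meixnerVal_zero (q : ℝ) (z : ℕ) : meixnerVal q 0 0 z = 1 := by
  simp [meixnerVal_eq_sum]

theorem meixnerVal_one (q : ℝ) (z : ℕ) : meixnerVal q 0 1 z = (q - 1) * z + q := by
  simp [meixnerVal_eq_sum, Finset.sum_range_succ]
  ring

/-- The Meixner polynomials with parameter `1`. -/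
def meixnerPoly (q : ℝ) : ℕ → ℝ[X]
  | 0 => 1
  | 1 => C (q - 1) * X + C q
  | n + 2 => C ((n : ℝ) + 2)⁻¹ * ((C (q - 1) * X + C ((n + 1) + (n + 2) * q)) *
      meixnerPoly q (n + 1) - C (q * (n + 1)) * meixnerPoly q n)

theorem meixnerPoly_add_two (q : ℝ) (n : ℕ) :
    C ((n : ℝ) + 2) * meixnerPoly q (n + 2) =
      (C (q - 1) * X + C ((n + 1) + (n + 2) * q)) * meixnerPoly q (n + 1) -
        C (q * (n + 1)) * meixnerPoly q n := by
  rw [meixnerPoly, ← mul_assoc, ← C_mul, mul_inv_cancel₀ (by positivity), C_1, one_mul]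

/-- Both sides obey the same recurrence. This transfers orthogonality, proved for values at
integers, to actual polynomials, whose derivatives enter the kernel on the diagonal. -/
theorem eval_meixnerPoly (q : ℝ) (n z : ℕ) :
    (meixnerPoly q n).eval (z : ℝ) = meixnerVal q 0 n z := by
  induction n using Nat.twoStepInduction with
  | zero => simp [meixnerPoly, meixnerVal_zero]
  | one => simp [meixnerPoly, meixnerVal_one]
  | more n ih0 ih1 =>
    have h := congrArg (Polynomial.eval (z : ℝ)) (meixnerPoly_add_two q n)
    simp only [eval_mul, eval_C, eval_sub, eval_add, eval_X, ih0, ih1] at h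
    have h2 := meixnerVal_recurrence q n z
    have h3 : (n : ℝ) + 2 ≠ 0 := by positivity
    refine mul_left_cancel₀ h3 ?_
    rw [h, h2]; ring

theorem natDegree_meixnerPoly_le (q : ℝ) (n : ℕ) : (meixnerPoly q n).natDegree ≤ n := by
  induction n using Nat.twoStepInduction with
  | zero => simp [meixnerPoly]
  | one => rw [meixnerPoly]; compute_degree
  | more n ih0 ih1 =>
    rw [meixnerPoly]
    refine (natDegree_C_mul_le _ _).trans ((natDegree_sub_le _ _).trans (max_le ?_ ?_))
    · refine natDegree_mul_le.trans ?_
      have : (C (q - 1) * X + C ((n + 1 : ℝ) + (n + 2) * q)).natDegree ≤ 1 := by compute_degree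
      omega
    · exact (natDegree_C_mul_le _ _).trans (by omega)

theorem coeff_meixnerPoly_self (q : ℝ) (n : ℕ) :
    (meixnerPoly q n).coeff n = (q - 1) ^ n / n.factorial := by
  induction n using Nat.twoStepInduction with
  | zero => simp [meixnerPoly]
  | one => rw [meixnerPoly]; simp
  | more n ih0 ih1 =>
    have h1 : (meixnerPoly q (n + 1)).coeff (n + 2) = 0 :=
      coeff_eq_zero_of_natDegree_lt (by have := natDegree_meixnerPoly_le q (n + 1); omega)
    have h0 : (meixnerPoly q n).coeff (n + 2) = 0 :=
      coeff_eq_zero_of_natDegree_lt (by have := natDegree_meixnerPoly_le q n; omega)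
    rw [meixnerPoly, coeff_C_mul, coeff_sub, coeff_C_mul, h0, add_mul, coeff_add, coeff_C_mul, h1,
      mul_assoc, coeff_C_mul, coeff_X_mul, ih1, Nat.factorial_succ (n + 1)]
    push_cast
    have : ((n + 1).factorial : ℝ) ≠ 0 := by positivity
    field_simp
    ring


/-! ### Orthonormal polynomials and the diagonal of the kernel -/

theorem integrable_and_integral_of_hasSum {μ : Measure ℕ} [IsFiniteMeasure μ] {f : ℕ → ℝ} {a : ℝ}
    (h : HasSum (fun x => μ.real {x} * f x) a) : Integrable f μ ∧ ∫ x, f x ∂μ = a := by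
  have hc : ∀ i : ℕ, μ {i} ≠ ∞ := fun i => measure_ne_top μ _
  -- Convergent unordered real series converge absolutely, so integrability needs no separate
  -- argument.
  have hs : Summable fun i : ℕ => (μ {i}).toReal * ‖f i‖ := by
    refine h.summable.norm.congr fun i => ?_
    rw [norm_mul, Real.norm_of_nonneg measureReal_nonneg, measureReal_def]
  have hi : Integrable f μ := by
    rw [← Measure.sum_smul_dirac μ, integrable_sum_dirac_iff (x := fun i => i) hc]
    exact hs
  exact ⟨hi, by rw [integral_countable hi]; exact h.tsum_eq⟩

instance (q : ℝ) : IsProbabilityMeasure (geo q) := by unfold geo; infer_instance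

theorem summable_pow_mul_geo {q : ℝ} (h0 : 0 < q) (h1 : q < 1) (k : ℕ) :
    Summable fun x : ℕ => (geo q).real {x} * (x : ℝ) ^ k := by
  have hn : ‖q‖ < 1 := by rwa [Real.norm_eq_abs, abs_of_pos h0]
  refine ((summable_pow_mul_geometric_of_norm_lt_one k hn).mul_left (1 - q)).congr fun x => ?_
  rw [geo_real_singleton h0 h1]; ring

theorem summable_eval_mul_geo {q : ℝ} (h0 : 0 < q) (h1 : q < 1) (f : ℝ[X]) :
    Summable fun x : ℕ => (geo q).real {x} * f.eval (x : ℝ) := by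
  induction f using Polynomial.induction_on' with
  | add f g hf hg => simpa [mul_add] using hf.add hg
  | monomial n a =>
    refine ((summable_pow_mul_geo h0 h1 n).mul_left a).congr fun x => ?_
    rw [eval_monomial]; ring

theorem integrable_eval_geo {q : ℝ} (h0 : 0 < q) (h1 : q < 1) (f : ℝ[X]) :
    Integrable (fun x : ℕ => f.eval (x : ℝ)) (geo q) :=
  (integrable_and_integral_of_hasSum (summable_eval_mul_geo h0 h1 f).hasSum).1

theorem polyInner_comm (q : ℝ) (f g : ℝ[X]) : polyInner q f g = polyInner q g f := by
  simp only [polyInner, mul_comm]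

theorem polyInner_C_mul (q a : ℝ) (f g : ℝ[X]) :
    polyInner q (C a * f) g = a * polyInner q f g := by
  simp only [polyInner, eval_mul, eval_C, mul_assoc, integral_const_mul]

theorem polyInner_mul_C (q a : ℝ) (f g : ℝ[X]) :
    polyInner q f (C a * g) = a * polyInner q f g := by
  rw [polyInner_comm, polyInner_C_mul, polyInner_comm]

theorem polyInner_sub {q : ℝ} (h0 : 0 < q) (h1 : q < 1) (f g h : ℝ[X]) :
    polyInner q (f - g) h = polyInner q f h - polyInner q g h := by
  simp only [polyInner, eval_sub, sub_mul]
  exact integral_sub (by simpa using integrable_eval_geo h0 h1 (f * h))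
    (by simpa using integrable_eval_geo h0 h1 (g * h))

theorem polyInner_sum {q : ℝ} (h0 : 0 < q) (h1 : q < 1) (s : Finset ℕ) (f : ℕ → ℝ[X]) (h : ℝ[X]) :
    polyInner q (∑ i ∈ s, f i) h = ∑ i ∈ s, polyInner q (f i) h := by
  simp only [polyInner, eval_finsetSum, Finset.sum_mul]
  exact integral_finsetSum s fun i _ => by simpa using integrable_eval_geo h0 h1 (f i * h)

theorem polyInner_meixnerPoly {q : ℝ} (h0 : 0 < q) (h1 : q < 1) (j l : ℕ) :
    polyInner q (meixnerPoly q j) (meixnerPoly q l) = if j = l then q ^ l else 0 := by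
  have h1' : 1 - q ≠ 0 := by linarith
  refine (integrable_and_integral_of_hasSum (hasSum_of_eq
    ((hasSum_meixnerVal_mul h0 h1 0 j l).mul_left (1 - q)) (fun x => ?_) ?_)).2
  · rw [geo_real_singleton h0 h1, eval_meixnerPoly, eval_meixnerPoly]
    simp; ring
  · split_ifs
    · simp; field_simp
    · simp

theorem exists_eq_sum_meixnerPoly {q : ℝ} (h1 : q < 1) (n : ℕ) :
    ∀ f : ℝ[X], f.degree < n → ∃ a : ℕ → ℝ, f = ∑ j ∈ Finset.range n, C (a j) * meixnerPoly q j := by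
  induction n with
  | zero =>
    intro f hf
    refine ⟨0, ?_⟩
    rw [Finset.range_zero, Finset.sum_empty, ← degree_eq_bot]
    simpa using hf
  | succ n ih =>
    intro f hf
    have hc : (meixnerPoly q n).coeff n ≠ 0 := by
      rw [coeff_meixnerPoly_self]
      have : q - 1 ≠ 0 := by linarith
      positivity
    set c := f.coeff n / (meixnerPoly q n).coeff n with hcdef
    obtain ⟨a, ha⟩ := ih (f - C c * meixnerPoly q n) (by
      rw [degree_lt_iff_coeff_zero]
      intro m hm
      rcases hm.eq_or_lt with rfl | hm
      · rw [coeff_sub, coeff_C_mul, hcdef]; field_simp; ring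
      · rw [coeff_sub, coeff_C_mul, coeff_eq_zero_of_natDegree_lt
          ((natDegree_meixnerPoly_le q n).trans_lt hm), (degree_lt_iff_coeff_zero _ _).1 hf m hm]
        simp)
    refine ⟨fun j => if j = n then c else a j, ?_⟩
    simp only [Finset.sum_range_succ, if_true]
    rw [← sub_eq_iff_eq_add, ha]
    refine Finset.sum_congr rfl fun j hj => ?_
    rw [if_neg (by have := Finset.mem_range.1 hj; omega)]

/-- The monic orthogonal polynomials are multiples of the Meixner polynomials. -/
theorem monicPoly_eq {q : ℝ} (h0 : 0 < q) (h1 : q < 1) (n : ℕ) :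
    monicPoly q n = C (n.factorial / (q - 1) ^ n) * meixnerPoly q n := by
  have hq : q - 1 ≠ 0 := by linarith
  induction n using Nat.strong_induction_on with
  | _ n ih =>
    have hb : ∀ j : ℕ, (j.factorial : ℝ) / (q - 1) ^ j ≠ 0 := fun j => by positivity
    rw [monicPoly]
    have hterm : ∀ j : Fin n, C (polyInner q (X ^ n) (monicPoly q j) /
        polyInner q (monicPoly q j) (monicPoly q j)) * monicPoly q j =
        C (polyInner q (X ^ n) (meixnerPoly q j) / q ^ (j : ℕ)) * meixnerPoly q j := by
      intro j
      rw [ih j j.2, polyInner_mul_C, polyInner_mul_C, polyInner_C_mul,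
        polyInner_meixnerPoly h0 h1, if_pos rfl, ← mul_assoc, ← C_mul]
      congr 2
      have := hb j
      field_simp
    rw [Finset.sum_congr rfl fun j _ => hterm j, Fin.sum_univ_eq_sum_range
      (fun j => C (polyInner q (X ^ n) (meixnerPoly q j) / q ^ j) * meixnerPoly q j) n]
    -- X ^ n minus the monic multiple has degree below n; pairing its expansion with each lower
    -- Meixner polynomial identifies the coefficients with the Gram–Schmidt ones.
    obtain ⟨a, ha⟩ := exists_eq_sum_meixnerPoly h1 n
      (X ^ n - C (n.factorial / (q - 1) ^ n) * meixnerPoly q n) (by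
        rw [degree_lt_iff_coeff_zero]
        intro m hm
        rcases hm.eq_or_lt with rfl | hm
        · rw [coeff_sub, coeff_C_mul, coeff_meixnerPoly_self, coeff_X_pow_self]
          field_simp
          simp
        · rw [coeff_sub, coeff_C_mul, coeff_eq_zero_of_natDegree_lt
            ((natDegree_meixnerPoly_le q n).trans_lt hm), coeff_X_pow, if_neg hm.ne']
          simp)
    have hcoef : ∀ j ∈ Finset.range n, a j = polyInner q (X ^ n) (meixnerPoly q j) / q ^ j := by
      intro j hj
      have h := congrArg (fun f => polyInner q f (meixnerPoly q j)) ha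
      simp only [polyInner_sub h0 h1, polyInner_sum h0 h1, polyInner_C_mul,
        polyInner_meixnerPoly h0 h1] at h
      rw [if_neg (by have := Finset.mem_range.1 hj; omega), Finset.sum_eq_single_of_mem j hj
        (fun b _ hb => by rw [if_neg hb, mul_zero]), if_pos rfl, mul_zero, sub_zero] at h
      rw [h]; field_simp
    rw [Finset.sum_congr rfl fun j hj => by rw [← hcoef j hj], ← ha]
    ring

/-- The n-th Meixner polynomial has norm r ^ n and leading sign (-1) ^ n, so dividing by (-r) ^ n
makes it orthonormal with positive leading coefficient. -/
theorem orthoPoly_eq {r : ℝ} (h0 : 0 < r) (h1 : r < 1) (n : ℕ) :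
    orthoPoly (r ^ 2) n = C ((-r) ^ n)⁻¹ * meixnerPoly (r ^ 2) n := by
  have hq0 : 0 < r ^ 2 := by positivity
  have hq1 : r ^ 2 < 1 := by nlinarith
  have hq1' : 0 < 1 - r ^ 2 := by linarith
  rw [orthoPoly, monicPoly_eq hq0 hq1, polyInner_mul_C, polyInner_C_mul,
    polyInner_meixnerPoly hq0 hq1, if_pos rfl, ← mul_assoc, ← C_mul]
  congr 2
  have e : (n.factorial : ℝ) / (r ^ 2 - 1) ^ n = (-1) ^ n * (n.factorial / (1 - r ^ 2) ^ n) := by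
    rw [show r ^ 2 - 1 = (-1) * (1 - r ^ 2) by ring, mul_pow]
    have : ((-1 : ℝ) ^ n) * (-1) ^ n = 1 := by rw [← mul_pow]; simp
    field_simp
    linear_combination -this
  have hs : (n.factorial : ℝ) / (r ^ 2 - 1) ^ n * (n.factorial / (r ^ 2 - 1) ^ n * (r ^ 2) ^ n) =
      (n.factorial / (1 - r ^ 2) ^ n * r ^ n) ^ 2 := by
    have : ((-1 : ℝ) ^ n) * (-1) ^ n = 1 := by rw [← mul_pow]; simp
    rw [e, ← pow_mul r, mul_comm 2 n, pow_mul]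
    linear_combination ((n.factorial / (1 - r ^ 2) ^ n * r ^ n) ^ 2) * this
  rw [hs, Real.sqrt_sq (by positivity), e, neg_pow r, mul_inv, mul_inv, ← inv_pow (-1 : ℝ),
    inv_neg_one]
  have : (n.factorial : ℝ) / (1 - r ^ 2) ^ n ≠ 0 := by positivity
  field_simp

theorem leadingCoeff_orthoPoly {r : ℝ} (h0 : 0 < r) (h1 : r < 1) (n : ℕ) :
    (orthoPoly (r ^ 2) n).leadingCoeff = (1 - r ^ 2) ^ n / (r ^ n * n.factorial) := by
  have hq1' : 0 < 1 - r ^ 2 := by nlinarith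
  have hc : (meixnerPoly (r ^ 2) n).coeff n = (-1) ^ n * ((1 - r ^ 2) ^ n / n.factorial) := by
    rw [coeff_meixnerPoly_self, show r ^ 2 - 1 = (-1) * (1 - r ^ 2) by ring, mul_pow]; ring
  have hd : (meixnerPoly (r ^ 2) n).natDegree = n := by
    refine le_antisymm (natDegree_meixnerPoly_le _ n) (le_natDegree_of_ne_zero ?_)
    rw [hc]; positivity
  rw [orthoPoly_eq h0 h1, leadingCoeff_C_mul_of_isUnit (by
    rw [isUnit_iff_ne_zero]
    exact inv_ne_zero (pow_ne_zero _ (by linarith))), leadingCoeff, hd, hc, neg_pow r]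
  field_simp

/-- The confluent Christoffel–Darboux formula for the Meixner polynomials. -/
theorem meixnerPoly_wronskian (q x : ℝ) (n : ℕ) :
    (n + 1) * ((meixnerPoly q (n + 1)).derivative.eval x * (meixnerPoly q n).eval x -
      (meixnerPoly q n).derivative.eval x * (meixnerPoly q (n + 1)).eval x) =
    (q - 1) * ∑ l ∈ Finset.range (n + 1), q ^ (n - l) * (meixnerPoly q l).eval x ^ 2 := by
  induction n with
  | zero => simp [meixnerPoly]
  | succ n ih =>
    have h := meixnerPoly_add_two q n
    have h1 := congrArg (Polynomial.eval x) h
    have h2 := congrArg (fun f => f.derivative.eval x) h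
    simp only [derivative_mul, derivative_sub, derivative_add, derivative_C, derivative_X,
      eval_mul, eval_add, eval_sub, eval_C, eval_X, zero_mul, zero_add,
      mul_one, add_zero] at h1 h2
    have hs : ∑ l ∈ Finset.range (n + 1 + 1), q ^ (n + 1 - l) * (meixnerPoly q l).eval x ^ 2 =
        q * ∑ l ∈ Finset.range (n + 1), q ^ (n - l) * (meixnerPoly q l).eval x ^ 2 +
          (meixnerPoly q (n + 1)).eval x ^ 2 := by
      rw [Finset.sum_range_succ, Finset.mul_sum]
      congr 1
      · refine Finset.sum_congr rfl fun l hl => ?_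
        rw [show n + 1 - l = n - l + 1 by have := Finset.mem_range.1 hl; omega, pow_succ]; ring
      · simp
    rw [hs]
    push_cast
    -- Cross-multiplying the recurrence and its derivative cancels the multiplication-by-x terms and
    -- leaves (q - 1) times the square of the polynomial of index n + 1.
    linear_combination (meixnerPoly q (n + 1)).eval x * h2 -
      (meixnerPoly q (n + 1)).derivative.eval x * h1 + q * ih

theorem kernel_self {r : ℝ} (h0 : 0 < r) (h1 : r < 1) {N : ℕ} (hN : 0 < N) (x : ℝ) :
    kernel (r ^ 2) N x x =
      ∑ l ∈ Finset.range N, (meixnerPoly (r ^ 2) l).eval x ^ 2 / (r ^ 2) ^ l := by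
  obtain ⟨n, rfl⟩ : ∃ n, N = n + 1 := ⟨N - 1, by omega⟩
  have hq1' : 0 < 1 - r ^ 2 := by nlinarith
  have hw := meixnerPoly_wronskian (r ^ 2) x n
  have hsum : ∑ l ∈ Finset.range (n + 1), (r ^ 2) ^ (n - l) * (meixnerPoly (r ^ 2) l).eval x ^ 2 =
      (r ^ 2) ^ n * ∑ l ∈ Finset.range (n + 1),
        (meixnerPoly (r ^ 2) l).eval x ^ 2 / (r ^ 2) ^ l := by
    rw [Finset.mul_sum]
    refine Finset.sum_congr rfl fun l hl => ?_
    have : (r ^ 2) ^ n = (r ^ 2) ^ (n - l) * (r ^ 2) ^ l := by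
      rw [← pow_add]; congr 1; have := Finset.mem_range.1 hl; omega
    rw [this]
    field_simp
  rw [hsum] at hw
  rw [kernel, if_pos rfl, Nat.add_sub_cancel, leadingCoeff_orthoPoly h0 h1,
    leadingCoeff_orthoPoly h0 h1, orthoPoly_eq h0 h1, orthoPoly_eq h0 h1, derivative_C_mul,
    derivative_C_mul]
  simp only [eval_mul, eval_C]
  set S := ∑ l ∈ Finset.range (n + 1), (meixnerPoly (r ^ 2) l).eval x ^ 2 / (r ^ 2) ^ l
  set A := (meixnerPoly (r ^ 2) (n + 1)).derivative.eval x
  set B := (meixnerPoly (r ^ 2) n).eval x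
  set D := (meixnerPoly (r ^ 2) n).derivative.eval x
  set E := (meixnerPoly (r ^ 2) (n + 1)).eval x
  have hr : (1 - r ^ 2) ^ n / (r ^ n * n.factorial) /
      ((1 - r ^ 2) ^ (n + 1) / (r ^ (n + 1) * (n + 1).factorial)) =
      r * (n + 1) / (1 - r ^ 2) := by
    rw [Nat.factorial_succ]
    push_cast
    field_simp
    ring
  have hm : ((-r) ^ (n + 1))⁻¹ * A * (((-r) ^ n)⁻¹ * B) - ((-r) ^ n)⁻¹ * D *
      (((-r) ^ (n + 1))⁻¹ * E) = -(r * (r ^ 2) ^ n)⁻¹ * (A * B - D * E) := by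
    have : (-r) ^ (n + 1) * (-r) ^ n = -(r * (r ^ 2) ^ n) := by
      rw [pow_succ, mul_right_comm, ← pow_add, ← two_mul, pow_mul, neg_sq]; ring
    rw [← inv_neg, ← this, mul_inv]
    ring
  rw [hr, hm]
  have : A * B - D * E = (r ^ 2 - 1) * ((r ^ 2) ^ n * S) / (n + 1) := by
    rw [eq_div_iff (by positivity), ← hw]; ring
  rw [this]
  field_simp
  ring


/-! ### One-point function and exact factorial moments -/

theorem natCard_embedding_eq {N : ℕ} (x : Fin N → ℕ) (y : ℕ) :
    Nat.card {s : Fin 1 ↪ Fin N // ∀ j, x (s j) = y} =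
      (Finset.univ.filter fun i => x i = y).card := by
  have e : {s : Fin 1 ↪ Fin N // ∀ j, x (s j) = y} ≃ {i // x i = y} :=
    { toFun := fun s => ⟨s.1 0, s.2 0⟩
      invFun := fun i => ⟨⟨fun _ => i.1, fun a b _ => Subsingleton.elim a b⟩, fun _ => i.2⟩
      left_inv := fun s => by
        refine Subtype.ext (DFunLike.ext _ _ fun j => ?_)
        obtain rfl := Subsingleton.elim 0 j
        rfl
      right_inv := fun i => rfl }
  rw [Nat.card_congr e, Nat.card_eq_fintype_card, Fintype.card_subtype]

theorem meanEmpirical_apply {N : ℕ} (P : Measure (Fin N → ℕ)) (s : Set ℕ) :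
    meanEmpirical P s = ∫⁻ x, (N : ℝ≥0∞)⁻¹ * ∑ i, Measure.dirac (x i) s ∂P := by
  rw [meanEmpirical, Measure.bind_apply (MeasurableSet.of_discrete)
    (Measurable.of_discrete.aemeasurable)]
  simp

theorem isProbabilityMeasure_meanEmpirical {N : ℕ} (hN : 0 < N) (P : Measure (Fin N → ℕ))
    [IsProbabilityMeasure P] : IsProbabilityMeasure (meanEmpirical P) := by
  refine ⟨?_⟩
  rw [meanEmpirical_apply]
  simp [ENNReal.inv_mul_cancel (Nat.cast_ne_zero.2 hN.ne') (ENNReal.natCast_ne_top N)]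

/-- Only the first correlation function enters: 1-tuples of particles at y count the particles
there, and the 1 × 1 determinant is the kernel on the diagonal. -/
theorem meanEmpirical_real_singleton {q : ℝ} {N : ℕ} {P : Measure (Fin N → ℕ)}
    (hP : IsMeixnerEnsemble q N P) (y : ℕ) :
    (meanEmpirical P).real {y} = (N : ℝ)⁻¹ * (kernel q N y y * (geo q).real {y}) := by
  have h := hP.determinantal 1 fun _ => y
  simp only [natCard_embedding_eq, Matrix.det_unique, Matrix.of_apply, Finset.univ_unique,
    Finset.prod_singleton] at h
  rw [← h, measureReal_def, meanEmpirical_apply, ← integral_const_mul,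
    integral_eq_lintegral_of_nonneg_ae (Filter.Eventually.of_forall fun x => by positivity)
      (Measurable.of_discrete.aestronglyMeasurable)]
  congr 1
  refine lintegral_congr fun x => ?_
  have : ∑ i, Measure.dirac (x i) ({y} : Set ℕ) =
      ((Finset.univ.filter fun i => x i = y).card : ℝ≥0∞) := by
    simp [Measure.dirac_apply' _ (MeasurableSet.of_discrete), Set.indicator_apply]
  rw [this]
  rcases Nat.eq_zero_or_pos N with rfl | hN
  · simp
  · rw [ENNReal.ofReal_mul (by positivity), ENNReal.ofReal_inv_of_pos (by positivity),
      ENNReal.ofReal_natCast, ENNReal.ofReal_natCast]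

theorem sum_range_choose_add (k M : ℕ) :
    ∑ i ∈ Finset.range M, (k + i).choose k = (M + k).choose (k + 1) := by
  induction M with
  | zero => simp
  | succ M ih =>
    rw [Finset.sum_range_succ, ih, show M + 1 + k = M + k + 1 by ring, Nat.choose_succ_succ,
      add_comm k M, add_comm]

/-- Exchange the sums and apply the hockey-stick identity. As n + m < N, every index up to the
degree of `connPoly` lies in the range and has N - j > 0. -/
theorem sum_sum_coeff_connPoly (r : ℝ) {n m N : ℕ} (hN : n + m < N) :
    ∑ l ∈ Finset.range N, ∑ j ∈ Finset.range (l + 1),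
        (connPoly r n m).coeff j ^ 2 * ((n + m + (l - j)).choose (n + m) : ℝ) =
      weightedSum r n m N / (n + m + 1).factorial := by
  have h := Finset.sum_range_diag_flip N fun j i =>
    (connPoly r n m).coeff j ^ 2 * ((n + m + i).choose (n + m) : ℝ)
  rw [h, weightedSum, Finset.sum_div]
  symm
  refine Finset.sum_subset_zero_on_sdiff (by intro i; simp; omega) ?_ ?_
  · intro j hj
    rw [Finset.mem_sdiff, Finset.mem_range, Finset.mem_range] at hj
    rw [← Finset.mul_sum, coeff_eq_zero_of_natDegree_lt
      (lt_of_le_of_lt (natDegree_connPoly_le r n m) (by omega))]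
    simp
  · intro j hj
    rw [Finset.mem_range] at hj
    have h1 := sum_range_choose_add (n + m) (N - j)
    rw [← Finset.mul_sum]
    have h2 : ∑ i ∈ Finset.range (N - j), ((n + m + i).choose (n + m) : ℝ) =
        (N - j + (n + m)).choose (n + m + 1) := by exact_mod_cast h1
    obtain ⟨d, hd⟩ : ∃ d, N - j = d + 1 := ⟨N - j - 1, by omega⟩
    rw [h2, hd, Nat.ascFactorial_eq_factorial_mul_choose,
      show d + 1 + (n + m) = d + (n + m + 1) by ring]
    push_cast
    have : ((n + m + 1).factorial : ℝ) ≠ 0 := by positivity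
    field_simp

/-- The shifted factorial moments of the mean empirical distribution. -/
theorem integral_descFactorial {r : ℝ} (h0 : 0 < r) (h1 : r < 1) {n m N : ℕ} (hN : n + m < N)
    {P : Measure (Fin N → ℕ)} (hP : IsMeixnerEnsemble (r ^ 2) N P) :
    Integrable (fun x : ℕ => ((x + m).descFactorial (n + m) : ℝ)) (meanEmpirical P) ∧
    ∫ x : ℕ, ((x + m).descFactorial (n + m) : ℝ) ∂(meanEmpirical P) =
      weightedSum r n m N / (((n + m : ℕ) + 1) * N * (1 - r ^ 2) ^ (n + m)) := by
  have := hP.isProbabilityMeasure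
  have := isProbabilityMeasure_meanEmpirical (show 0 < N by omega) P
  have hq0 : 0 < r ^ 2 := by positivity
  have hq1 : r ^ 2 < 1 := by nlinarith
  have hq1' : 0 < 1 - r ^ 2 := by linarith
  have hN0 : (N : ℝ) ≠ 0 := by
    have : 0 < N := by omega
    positivity
  have h := (hasSum_sum (s := Finset.range N) fun l _ =>
    hasSum_choose_mul_meixnerVal_sq h0 h1 n m l).mul_left ((N : ℝ)⁻¹ * (n + m).factorial)
  refine integrable_and_integral_of_hasSum (hasSum_of_eq h (fun x => ?_) ?_)
  · rw [meanEmpirical_real_singleton hP, kernel_self h0 h1 (by omega),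
      geo_real_singleton hq0 hq1, Nat.descFactorial_eq_factorial_mul_choose]
    push_cast
    simp only [eval_meixnerPoly, Finset.sum_mul, Finset.mul_sum]
    refine Finset.sum_congr rfl fun l _ => ?_
    ring
  · rw [← Finset.mul_sum, sum_sum_coeff_connPoly r hN, Nat.factorial_succ]
    push_cast
    have : ((n + m).factorial : ℝ) ≠ 0 := by positivity
    field_simp

theorem integrable_pow_meanEmpirical {r : ℝ} (h0 : 0 < r) (h1 : r < 1) {N : ℕ} (hN : 0 < N)
    {P : Measure (Fin N → ℕ)} (hP : IsMeixnerEnsemble (r ^ 2) N P) (k : ℕ) :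
    Integrable (fun x : ℕ => (x : ℝ) ^ k) (meanEmpirical P) := by
  have := hP.isProbabilityMeasure
  have := isProbabilityMeasure_meanEmpirical hN P
  have hq0 : 0 < r ^ 2 := by positivity
  have hq1 : r ^ 2 < 1 := by nlinarith
  have h := summable_eval_mul_geo hq0 hq1 (C (N : ℝ)⁻¹ * (∑ l ∈ Finset.range N,
    meixnerPoly (r ^ 2) l ^ 2 * C ((r ^ 2) ^ l)⁻¹) * X ^ k)
  refine (integrable_and_integral_of_hasSum (hasSum_of_eq h.hasSum (fun x => ?_) rfl)).1
  rw [meanEmpirical_real_singleton hP, kernel_self h0 h1 hN]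
  simp only [eval_mul, eval_C, eval_finsetSum, eval_pow, eval_X, div_eq_mul_inv]
  ring

/-! ### Comparing shifted factorials with powers -/

theorem descFactorial_step (x n : ℕ) : (x + (n + 1)).descFactorial (n + 1 + (n + 1)) =
    (x + n + 1) * (x - n) * (x + n).descFactorial (n + n) := by
  rw [← add_assoc x, show n + 1 + (n + 1) = n + n + 1 + 1 by ring, Nat.succ_descFactorial_succ,
    Nat.descFactorial_succ, show x + n - (n + n) = x - n by omega]
  ring

/-- Each increment of n adds a factor at both ends, with product (x + n + 1)(x - n) ≤ x(x + 1); the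
first-order shifts nearly cancel. -/
theorem descFactorial_le (x n : ℕ) :
    (x + n).descFactorial (n + n) ≤ (x * (x + 1)) ^ n := by
  induction n with
  | zero => simp
  | succ n ih =>
    rw [descFactorial_step, pow_succ']
    refine Nat.mul_le_mul ?_ ih
    rcases le_total n x with h | h
    · obtain ⟨d, rfl⟩ := Nat.exists_eq_add_of_le h
      rw [Nat.add_sub_cancel_left]
      nlinarith
    · simp [Nat.sub_eq_zero_of_le h]

theorem descFactorial_succ_eq (x n : ℕ) : (x + (n + 1)).descFactorial (n + (n + 1)) =
    (x + n + 1) * (x + n).descFactorial (n + n) := by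
  rw [← add_assoc x, ← add_assoc n, Nat.succ_descFactorial_succ]

/-- For x < n the factorial is zero; for x ≥ n the excess (1 + 1 / x) ^ n is at most e. The unpaired
factor x + n + 1 ≤ 3x accounts for the 3. -/
theorem descFactorial_le_mul_pow {n m : ℕ} (hnm : m = n ∨ m = n + 1) (hn : 1 ≤ n) (x : ℕ) :
    ((x + m).descFactorial (n + m) : ℝ) ≤ 3 * Real.exp 1 * (x : ℝ) ^ (n + m) := by
  rcases lt_or_ge x n with hx | hx
  · rw [Nat.descFactorial_of_lt (by omega)]
    have := Real.exp_pos 1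
    simp only [Nat.cast_zero]
    positivity
  have hx0 : (0 : ℝ) < x := by
    have : 0 < x := by omega
    positivity
  have hxn : (n : ℝ) ≤ x := by exact_mod_cast hx
  have hx1 : (1 : ℝ) ≤ x := by exact_mod_cast hn.trans hx
  have hmain : ((x + n).descFactorial (n + n) : ℝ) ≤ Real.exp 1 * (x : ℝ) ^ (n + n) := by
    have h1 : ((x + n).descFactorial (n + n) : ℝ) ≤ ((x : ℝ) * (x + 1)) ^ n := by
      exact_mod_cast descFactorial_le x n
    have h2 : (x : ℝ) * (x + 1) ≤ x ^ 2 * Real.exp (1 / x) := by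
      have := Real.add_one_le_exp (1 / (x : ℝ))
      calc (x : ℝ) * (x + 1) = x ^ 2 * (1 / x + 1) := by field_simp; ring
        _ ≤ _ := by gcongr
    have h3 : Real.exp (1 / x) ^ n ≤ Real.exp 1 := by
      rw [← Real.exp_nat_mul]
      refine Real.exp_le_exp.2 ?_
      rw [mul_one_div, div_le_one hx0]; exact hxn
    calc _ ≤ ((x : ℝ) * (x + 1)) ^ n := h1
      _ ≤ (x ^ 2 * Real.exp (1 / x)) ^ n := by gcongr
      _ = Real.exp (1 / x) ^ n * (x : ℝ) ^ (n + n) := by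
          rw [mul_pow, ← pow_mul, two_mul, mul_comm]
      _ ≤ _ := by gcongr
  have hpos : 0 ≤ Real.exp 1 * (x : ℝ) ^ (n + n) := by positivity
  rcases hnm with rfl | rfl
  · linarith
  · rw [descFactorial_succ_eq]
    push_cast
    calc _ ≤ (3 * (x : ℝ)) * (Real.exp 1 * (x : ℝ) ^ (n + n)) := by
          gcongr
          linarith
      _ = _ := by ring

/-- Each of the n pairs is at least x² - n² = x²(1 - v) ≥ x² e ^ (-2v) with v = (n / x)² ≤ 1/4; an
unpaired factor is at least x. -/
theorem pow_le_mul_descFactorial {n m : ℕ} (hnm : m = n ∨ m = n + 1) {x : ℕ} (hx : 2 * n ≤ x)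
    (hx0 : 0 < x) : (x : ℝ) ^ (n + m) ≤ Real.exp (2 * n * ((n : ℝ) / x) ^ 2) *
      ((x + m).descFactorial (n + m) : ℝ) := by
  have hxr : (0 : ℝ) < x := by positivity
  set v : ℝ := ((n : ℝ) / x) ^ 2 with hv
  have hv0 : 0 ≤ v := by positivity
  have hv4 : v ≤ 1 / 4 := by
    have : (n : ℝ) / x ≤ 1 / 2 := by
      rw [div_le_div_iff₀ hxr two_pos]
      have : 2 * (n : ℝ) ≤ x := by exact_mod_cast hx
      linarith
    calc v ≤ (1 / 2) ^ 2 := by rw [hv]; gcongr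
      _ = _ := by norm_num
  have hstep : ∀ i ≤ n, (x : ℝ) ^ (i + i) * Real.exp (-(2 * v)) ^ i ≤
      ((x + i).descFactorial (i + i) : ℝ) := by
    intro i hi
    induction i with
    | zero => simp
    | succ i ih =>
      have ih' := ih (by omega)
      rw [descFactorial_step]
      push_cast
      rw [Nat.cast_sub (by omega)]
      have hin : (i : ℝ) ≤ n := by exact_mod_cast (by omega : i ≤ n)
      have hix : (i : ℝ) ≤ x := by exact_mod_cast (by omega : i ≤ x)
      have h1 : (x : ℝ) ^ 2 * Real.exp (-(2 * v)) ≤ ((x : ℝ) + i + 1) * (x - i) := by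
        have h2 : Real.exp (-(2 * v)) ≤ 1 - v := by
          have := exp_sub_sq_le_one_add (u := -v) (by rw [abs_neg, abs_of_nonneg hv0]; linarith)
          refine (Real.exp_le_exp.2 ?_).trans (this.trans (by linarith))
          nlinarith
        have h3 : (x : ℝ) ^ 2 * (1 - v) = x ^ 2 - n ^ 2 := by rw [hv]; field_simp
        have h4 : (x : ℝ) ^ 2 * Real.exp (-(2 * v)) ≤ x ^ 2 * (1 - v) := by gcongr
        have h5 : (0 : ℝ) ≤ i := by positivity
        have h6 : (i : ℝ) ^ 2 ≤ n ^ 2 := by gcongr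
        have h7 : (i : ℝ) + 1 ≤ n := by exact_mod_cast hi
        nlinarith
      calc _ = ((x : ℝ) ^ 2 * Real.exp (-(2 * v))) *
            ((x : ℝ) ^ (i + i) * Real.exp (-(2 * v)) ^ i) := by ring
        _ ≤ _ := by
            refine mul_le_mul h1 ih' (by positivity) ?_
            exact mul_nonneg (by positivity) (by linarith)
  have hmain : (x : ℝ) ^ (n + n) ≤ Real.exp (2 * n * v) * ((x + n).descFactorial (n + n) : ℝ) := by
    have h := mul_le_mul_of_nonneg_left (hstep n le_rfl) (Real.exp_pos (2 * n * v)).le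
    refine le_trans (le_of_eq ?_) h
    rw [← Real.exp_nat_mul, mul_left_comm, ← Real.exp_add]
    rw [show 2 * n * v + n * -(2 * v) = 0 by ring, Real.exp_zero, mul_one]
  rcases hnm with rfl | rfl
  · exact hmain
  · rw [descFactorial_succ_eq, ← add_assoc, pow_succ]
    push_cast
    have h0 : (0 : ℝ) ≤ n := by positivity
    calc (x : ℝ) ^ (n + n) * x
        ≤ (Real.exp (2 * n * v) * ((x + n).descFactorial (n + n) : ℝ)) * (x + n + 1) := by
          gcongr
          linarith
      _ = _ := by ring

theorem sq_le_four_mul_two_pow (k : ℕ) : k ^ 2 ≤ 4 * 2 ^ k := by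
  rcases le_or_gt k 3 with h | h
  · interval_cases k <;> norm_num
  · induction k, h using Nat.le_induction with
    | base => norm_num
    | succ k hk ih => rw [pow_succ 2]; nlinarith

/-! ### Moment bounds and the theorem -/

/-- The two-sided bound for the moments, in terms of `r = √q` and `k = n + m`. -/
theorem moment_bounds {r T : ℝ} (h0 : 0 < r) (h1 : r < 1) {n m N : ℕ}
    (hnm : m = n ∨ m = n + 1) (hn : 1 ≤ n) (hkr : 1 ≤ ((n + m : ℕ) : ℝ) * r)
    (hN : 2 * (n + m) ≤ N) (hT : ((n + m : ℕ) : ℝ) ^ 3 ≤ T * (N : ℝ) ^ 2)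
    {P : Measure (Fin N → ℕ)} (hP : IsMeixnerEnsemble (r ^ 2) N P) {Z : ℝ}
    (hZ : Z = ((1 + r) ^ 2 / (1 - r ^ 2) * N) ^ (n + m) /
      (((n + m : ℕ) : ℝ) * √(((n + m : ℕ) : ℝ) * r))) :
    (1 / 216) * Real.exp (-(5 + 6 * T)) / 2 * Z ≤
        ∫ x : ℕ, (x : ℝ) ^ (n + m) ∂(meanEmpirical P) ∧
      ∫ x : ℕ, (x : ℝ) ^ (n + m) ∂(meanEmpirical P) ≤
        (4 * Real.exp (5 * T + 1 / 2) + 4) * Z := by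
  have := hP.isProbabilityMeasure
  have := isProbabilityMeasure_meanEmpirical (show 0 < N by omega) P
  obtain ⟨hDi, hDe⟩ := integral_descFactorial h0 h1 (show n + m < N by omega) hP
  have hXi := integrable_pow_meanEmpirical h0 h1 (show 0 < N by omega) hP (n + m)
  have hup := weightedSum_le h0 h1.le hnm (by omega) hN hT
  have hlo := le_weightedSum h0 h1.le hnm hkr hN hT
  have hq1' : 0 < 1 - r ^ 2 := by nlinarith
  have hNr : (0 : ℝ) < N := by
    have : 0 < N := by omega
    positivity
  set ν := meanEmpirical P
  set M := ∫ x : ℕ, ((x + m).descFactorial (n + m) : ℝ) ∂ν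
  have hkpos : 1 ≤ n + m := by omega
  have hdesc := fun x => descFactorial_le_mul_pow hnm hn x
  -- Above N / 2 the comparison exponent 2n(n / x)² is at most k³ / N² ≤ T; below N / 2 the crude
  -- bound (N / 2) ^ k suffices.
  have hpow : ∀ x : ℕ, (x : ℝ) ^ (n + m) ≤
      Real.exp T * ((x + m).descFactorial (n + m) : ℝ) + ((N : ℝ) / 2) ^ (n + m) := by
    intro x
    rcases le_or_gt (x : ℝ) (N / 2) with hx | hx
    · have : (x : ℝ) ^ (n + m) ≤ ((N : ℝ) / 2) ^ (n + m) := by gcongr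
      have h2 : 0 ≤ Real.exp T * ((x + m).descFactorial (n + m) : ℝ) := by positivity
      linarith
    · have hx' : N < 2 * x := by
        have : (N : ℝ) < 2 * x := by linarith
        exact_mod_cast this
      have h2 := pow_le_mul_descFactorial hnm (x := x) (by omega) (by omega)
      have h3 : 2 * n * ((n : ℝ) / x) ^ 2 ≤ T := by
        have hxr : (0 : ℝ) < x := by linarith
        have h4 : (n : ℝ) / x ≤ (((n + m : ℕ) : ℝ) / 2) / (N / 2) := by
          gcongr
          have : 2 * (n : ℝ) ≤ (n + m : ℕ) := by exact_mod_cast (by omega : 2 * n ≤ n + m)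
          linarith
        have h5 : 2 * (n : ℝ) ≤ (n + m : ℕ) := by exact_mod_cast (by omega : 2 * n ≤ n + m)
        calc 2 * n * ((n : ℝ) / x) ^ 2
            ≤ ((n + m : ℕ) : ℝ) * ((((n + m : ℕ) : ℝ) / 2) / (N / 2)) ^ 2 := by gcongr
          _ = ((n + m : ℕ) : ℝ) ^ 3 / N ^ 2 := by field_simp
          _ ≤ T := by rw [div_le_iff₀ (by positivity)]; exact hT
      have h6 : (0 : ℝ) ≤ ((N : ℝ) / 2) ^ (n + m) := by positivity
      have h7 : Real.exp (2 * n * ((n : ℝ) / x) ^ 2) * ((x + m).descFactorial (n + m) : ℝ) ≤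
          Real.exp T * ((x + m).descFactorial (n + m) : ℝ) := by gcongr
      linarith
  have hI1 : M ≤ 3 * Real.exp 1 * ∫ x : ℕ, (x : ℝ) ^ (n + m) ∂ν := by
    rw [← integral_const_mul]
    exact integral_mono hDi (hXi.const_mul _) hdesc
  have hI2 : ∫ x : ℕ, (x : ℝ) ^ (n + m) ∂ν ≤ Real.exp T * M + ((N : ℝ) / 2) ^ (n + m) := by
    have h := integral_mono hXi ((hDi.const_mul (Real.exp T)).add
      (integrable_const (((N : ℝ) / 2) ^ (n + m)))) hpow
    simp only [Pi.add_apply] at h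
    rw [integral_add (hDi.const_mul _) (integrable_const _), integral_const_mul] at h
    simpa using h
  set k := n + m with hkdef
  have hkr1 : (1 : ℝ) ≤ k := by exact_mod_cast hkpos
  have hkr0 : (0 : ℝ) < k := by linarith
  have hs0 : 0 < √((k : ℝ) * r) := Real.sqrt_pos.2 (by positivity)
  set Y := (N : ℝ) ^ (k + 1) * (1 + r) ^ (2 * k) / √((k : ℝ) * r) with hY
  have hY0 : 0 < Y := by positivity
  set Q := ((k : ℝ) + 1) * N * (1 - r ^ 2) ^ k with hQ
  have hQ0 : 0 < Q := by positivity
  have hYQ : Y / Q = k / (k + 1) * Z := by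
    rw [hY, hQ, hZ, mul_pow, div_pow, ← pow_mul, pow_succ (N : ℝ)]
    field_simp
  have hZ0 : 0 < Z := by rw [hZ]; positivity
  have hYQ1 : Y / Q ≤ Z := by
    rw [hYQ]
    refine mul_le_of_le_one_left hZ0.le ?_
    rw [div_le_one (by positivity)]; linarith
  have hYQ2 : Z / 2 ≤ Y / Q := by
    rw [hYQ, div_eq_inv_mul]
    refine mul_le_mul_of_nonneg_right ?_ hZ0.le
    rw [inv_eq_one_div, div_le_div_iff₀ two_pos (by positivity)]; linarith
  have hM1 : M ≤ 4 * Real.exp (4 * T + 1 / 2) * Z := by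
    rw [hDe, div_le_iff₀ hQ0]
    refine hup.trans ((mul_le_mul_of_nonneg_left ((div_le_iff₀ hQ0).1 hYQ1)
      (by positivity)).trans_eq ?_)
    ring
  have hM2 : (1 / 36) * Real.exp (-(4 + 6 * T)) * (Z / 2) ≤ M := by
    rw [hDe, le_div_iff₀ hQ0]
    refine le_trans (le_of_eq ?_) ((mul_le_mul_of_nonneg_left ((le_div_iff₀ hQ0).1 hYQ2)
      (by positivity)).trans hlo)
    ring
  -- The edge factor is at least 1 and √(k r) ≤ k, so Z ≥ N ^ k / k², and the gain 2 ^ (-k) absorbs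
  -- k² up to the factor 4.
  have hhalf : ((N : ℝ) / 2) ^ k ≤ 4 * Z := by
    have hb : (1 : ℝ) ≤ (1 + r) ^ 2 / (1 - r ^ 2) := by
      rw [le_div_iff₀ hq1']; nlinarith
    have h2 : (N : ℝ) ^ k ≤ ((1 + r) ^ 2 / (1 - r ^ 2) * N) ^ k := by
      gcongr
      exact le_mul_of_one_le_left hNr.le hb
    have h3 : √((k : ℝ) * r) ≤ k := by
      rw [Real.sqrt_le_left hkr0.le]
      nlinarith
    have h4 : (N : ℝ) ^ k / (k * k) ≤ Z := by
      rw [hZ]; gcongr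
    have h5 : (k : ℝ) ^ 2 ≤ 4 * 2 ^ k := by exact_mod_cast sq_le_four_mul_two_pow k
    have h6 : ((N : ℝ) / 2) ^ k ≤ 4 * ((N : ℝ) ^ k / (k * k)) := by
      rw [div_pow, ← mul_div_assoc, div_le_div_iff₀ (by positivity) (by positivity)]
      nlinarith [mul_le_mul_of_nonneg_left h5 (by positivity : 0 ≤ (N : ℝ) ^ k)]
    linarith
  constructor
  · have e : Real.exp (-(4 + 6 * T)) = Real.exp 1 * Real.exp (-(5 + 6 * T)) := by
      rw [← Real.exp_add]; ring_nf
    rw [e] at hM2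
    have h2 := hM2.trans hI1
    have h3 := Real.exp_pos 1
    refine le_of_mul_le_mul_left (le_trans ?_ h2) (by positivity : 0 < 3 * Real.exp 1)
    have : 0 ≤ Real.exp 1 * Real.exp (-(5 + 6 * T)) * Z := by positivity
    linarith
  · have e : Real.exp (5 * T + 1 / 2) = Real.exp T * Real.exp (4 * T + 1 / 2) := by
      rw [← Real.exp_add]; ring_nf
    have h2 := mul_le_mul_of_nonneg_left hM1 (Real.exp_pos T).le
    rw [e]
    linarith

theorem rpow_scale_eq {q k : ℝ} (hq : 0 < q) (hk : 0 < k) :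
    (q ^ (1 / 6 : ℝ) * k) ^ (-(3 / 2) : ℝ) = 1 / (k * √(k * √q)) := by
  rw [Real.mul_rpow (by positivity) hk.le, ← Real.rpow_mul hq.le, Real.sqrt_eq_rpow,
    Real.sqrt_eq_rpow, Real.mul_rpow hk.le (by positivity), ← Real.rpow_mul hq.le]
  have e : k ^ (-(3 / 2) : ℝ) = (k * k ^ (1 / 2 : ℝ))⁻¹ := by
    rw [← Real.rpow_one_add' hk.le (by norm_num), ← Real.rpow_neg hk.le]; norm_num
  have e2 : q ^ (1 / 6 * -(3 / 2) : ℝ) = (q ^ (1 / 2 * (1 / 2) : ℝ))⁻¹ := by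
    rw [← Real.rpow_neg hq.le]; norm_num
  rw [e, e2, ← mul_assoc, one_div (_ * _), mul_inv (k * k ^ (1 / 2 : ℝ)), mul_comm]

end Meixner

end

theorem theoremt (W : ℝ) (hW : 0 < W) :
    ∃ (C : ℝ) (N₀ : ℕ), 0 < C ∧ 0 < N₀ ∧
      ∀ (N k : ℕ) (q : ℝ), N₀ ≤ N → 1 ≤ k → (k : ℝ) ≤ W * (N : ℝ) ^ (2 / 3 : ℝ) →
        q ∈ Set.Ico ((k : ℝ) ^ (-2 : ℤ)) 1 →
        ∀ P : Measure (Fin N → ℕ), Meixner.IsMeixnerEnsemble q N P →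
          Integrable (fun x : ℕ => (x : ℝ) ^ k) (Meixner.meanEmpirical P) ∧
          C⁻¹ * (q ^ (1 / 6 : ℝ) * (k : ℝ)) ^ (-(3 / 2) : ℝ) * (Meixner.edge q * (N : ℝ)) ^ k ≤
            ∫ x : ℕ, (x : ℝ) ^ k ∂(Meixner.meanEmpirical P) ∧
          ∫ x : ℕ, (x : ℝ) ^ k ∂(Meixner.meanEmpirical P) ≤
            C * (q ^ (1 / 6 : ℝ) * (k : ℝ)) ^ (-(3 / 2) : ℝ) * (Meixner.edge q * (N : ℝ)) ^ k := by
  set a : ℝ := (1 / 216) * Real.exp (-(5 + 6 * W ^ 3)) / 2 with ha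
  set b : ℝ := 4 * Real.exp (5 * W ^ 3 + 1 / 2) + 4 with hb
  have ha0 : 0 < a := by positivity
  have hb0 : 0 < b := by positivity
  -- The threshold gives 8W³ ≤ N; with k³ ≤ W³N² this yields (2k)³ ≤ N³, that is 2k ≤ N.
  refine ⟨b + a⁻¹, ⌈8 * W ^ 3⌉₊ + 1, by positivity, by omega, ?_⟩
  intro N k q hN hk1 hkW hq P hP
  have hkr : (1 : ℝ) ≤ k := by exact_mod_cast hk1
  have hk0 : (0 : ℝ) < k := by linarith
  have hqk : ((k : ℝ) ^ 2)⁻¹ ≤ q := by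
    have := hq.1
    rwa [zpow_neg, zpow_ofNat] at this
  have hq0 : 0 < q := lt_of_lt_of_le (by positivity) hqk
  have hq1 := hq.2
  -- For k = 1 the range [k⁻², 1) for q is empty; k ≥ 2 makes the half n = ⌊k / 2⌋ at least 1.
  have hk2 : 2 ≤ k := by
    rcases hk1.eq_or_lt with rfl | h
    · norm_num at hqk
      linarith
    · exact h
  have hNpos : 0 < N := by omega
  have hNr : (0 : ℝ) < N := by positivity
  have hT : (k : ℝ) ^ 3 ≤ W ^ 3 * (N : ℝ) ^ 2 := by
    calc (k : ℝ) ^ 3 ≤ (W * (N : ℝ) ^ (2 / 3 : ℝ)) ^ 3 := by gcongr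
      _ = W ^ 3 * (N : ℝ) ^ 2 := by
          rw [mul_pow, ← Real.rpow_natCast ((N : ℝ) ^ (2 / 3 : ℝ)), ← Real.rpow_mul hNr.le]
          norm_num
  have hN2 : 2 * k ≤ N := by
    have h1 : 8 * W ^ 3 ≤ N := by
      refine (Nat.le_ceil _).trans ?_
      exact_mod_cast (by omega : ⌈8 * W ^ 3⌉₊ ≤ N)
    have h2 : (2 * (k : ℝ)) ^ 3 ≤ (N : ℝ) ^ 3 := by
      have := mul_le_mul_of_nonneg_right h1 (sq_nonneg (N : ℝ))
      nlinarith
    have h3 : 2 * (k : ℝ) ≤ N := le_of_pow_le_pow_left₀ (by norm_num) hNr.le h2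
    exact_mod_cast h3
  obtain ⟨n, m, hnm, hn, rfl⟩ : ∃ n m : ℕ, (m = n ∨ m = n + 1) ∧ 1 ≤ n ∧ k = n + m :=
    ⟨k / 2, k - k / 2, by omega, by omega, by omega⟩
  set r := √q with hr
  have hr0 : 0 < r := Real.sqrt_pos.2 hq0
  have hrq : r ^ 2 = q := Real.sq_sqrt hq0.le
  have hr1 : r < 1 := by nlinarith
  -- The condition q ≥ k⁻² says exactly that k r ≥ 1, so the standard-deviation scale √(k r) is at
  -- least 1.
  have hkr1 : 1 ≤ ((n + m : ℕ) : ℝ) * r := by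
    have h2 : (1 : ℝ) ^ 2 ≤ (((n + m : ℕ) : ℝ) * r) ^ 2 := by
      rw [mul_pow, hrq, one_pow]
      rwa [inv_le_iff_one_le_mul₀' (by positivity)] at hqk
    exact le_of_pow_le_pow_left₀ two_ne_zero (by positivity) h2
  rw [← hrq] at hP
  obtain ⟨hlo, hup⟩ := Meixner.moment_bounds hr0 hr1 hnm hn hkr1 hN2 hT hP rfl
  refine ⟨Meixner.integrable_pow_meanEmpirical hr0 hr1 hNpos hP _, ?_, ?_⟩
  all_goals
    rw [Meixner.rpow_scale_eq hq0 hk0, Meixner.edge, ← hr, ← hrq]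
    set Z := ((1 + r) ^ 2 / (1 - r ^ 2) * N) ^ (n + m) /
      (((n + m : ℕ) : ℝ) * √(((n + m : ℕ) : ℝ) * r)) with hZ
    have hZ0 : 0 ≤ Z := by
      have : 0 < 1 - r ^ 2 := by linarith
      positivity
    rw [mul_assoc, one_div_mul_eq_div]
  · refine le_trans (mul_le_mul_of_nonneg_right ?_ hZ0) hlo
    rw [inv_le_comm₀ (by positivity) ha0]
    linarith
  · refine hup.trans (mul_le_mul_of_nonneg_right ?_ hZ0)
    have : 0 < a⁻¹ := by positivity
    linarith
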